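/- Let $d\ge 1$, $q\in(0,1)$, $\Omega=\{0,1\}^{\mathbb Z^d}$ (zeros are empty sites), and let $\mu$ be the product Bernoulli measure on $\Omega$ with $\mu(\eta_x=1)=1-q$. Write $\eta^x$ for $\eta$ flipped at $x$, $(\eta_{z+\cdot})_x=\eta_{z+x}$, and $e_1,\dots,e_d$ for the canonical basis of $\mathbb Z^d$. Consider a kinetically constrained model, i.e. constraints $c_x:\Omega\to\{0,1\}$, $x\in\mathbb Z^d$, that are translation invariant, such that $c_x(\eta)$ depends only on $\eta$ in a fixed finite neighbourhood of $x$ (translated with $x$), does not depend on $\eta_x$, and is non-increasing in $\eta$. For local functions $f$ (functions of finitely many coordinates) put $$\mathcal L_Ef(\eta)=\sum_{y\in\mathbb Z^d}c_y(\eta)\big((1-q)(1-\eta_y)+q\eta_y\big)\,[f(\eta^y)-f(\eta)],$$ $$\mathcal Lf(\eta)=\mathcal L_Ef(\eta)+\sum_{i=1}^d\sum_{\alpha=\pm1}(1-\eta_0)(1-\eta_{\alpha e_i})\,[f(\eta_{\alpha e_i+\cdot})-f(\eta)],$$ and denote their closures in $L^2(\mu)$ by the same letters; $\mathcal L$ is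 the generator of the environment seen from a tracer that jumps at rate one between neighbouring empty sites. Let $$\mathrm{gap}(\mathcal L_E)=\inf\frac{-\mu(f\mathcal L_Ef)}{\mathrm{Var}_\mu(f)},$$ the infimum being over all $f\in L^2(\mu)$ in the domain of $\mathcal L_E$ with $\mathrm{Var}_\mu(f)\ne0$. For $u\in\mathbb R^d$ let $$j_u(\eta)=(1-\eta_0)\sum_{i=1}^d\sum_{\alpha=\pm1}(1-\eta_{\alpha e_i})\,\alpha u_i ,$$ and define the diffusion matrix $D$ by $$D_{ik}=q^2\delta_{ik}-\int_0^\infty\mu\big(j_{e_i}e^{t\mathcal L}j_{e_k}\big)\,dt .$$ Then $\mathcal L$ generates a strongly continuous contraction semigroup $(e^{t\mathcal L})_{t\ge0}$ on $L^2(\mu)$; for every $u\in\mathbb R^d$ the function $t\mapsto\mu(j_ue^{t\mathcal L}j_u)$ is integrable on $(0,\infty)$ and $$u\cdot Du=q^2\|u\|_2^2-\int_0^\infty\mu\big(j_ue^{t\mathcal L}j_u\big)\,dt ;$$ and for every $u\in\mathbb R^d$ $$q^2\|u\|_2^2\;\ge\;u\cdot Du\;\ge\;\frac{\mathrm{gap}(\mathcal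 L_E)}{4d+\mathrm{gap}(\mathcal L_E)}\,q^2\|u\|_2^2 .$$ In particular, if $\mathrm{gap}(\mathcal L_E)>0$, then $D$ is (symmetric) positive definite. -/

import Mathlib

open MeasureTheory Filter Topology
open scoped NNReal ENNReal unitInterval

noncomputable section

namespace Tracer

/-! ## Configurations -/

/-- The lattice `ℤ^d`. -/
abbrev Site (d : ℕ) : Type := Fin d → ℤ

/-- `{0,1}^{ℤ^d}`: `true` is an occupied site (a one), `false` is an empty site (a zero). -/
abbrev Config (d : ℕ) : Type := Site d → Bool

variable {d : ℕ}

/-- The occupation number `η_x`, as a real number. -/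
def occ (η : Config d) (x : Site d) : ℝ := if η x then 1 else 0

/-- The configuration `η^x`, in which the occupation variable at `x` is flipped. -/
def flipAt (x : Site d) (η : Config d) : Config d := Function.update η x (!η x)

/-- The translated configuration `η_{z+·}`. -/
def shift (z : Site d) (η : Config d) : Config d := fun x => η (z + x)

/-- The `i`-th vector of the canonical basis of `ℤ^d`. -/
def unitVec (i : Fin d) : Site d := Pi.single i 1

/-- The product Bernoulli measure under which each site is empty with probability `q` and occupied
with probability `1 - q`. -/
def mu (d : ℕ) (q : I) : Measure (Config d) :=
  Measure.infinitePi fun _ => ProbabilityTheory.bernoulliMeasure false true q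

instance (q : I) : IsProbabilityMeasure (mu d q) := by
  unfold mu; infer_instance

/-- The real Hilbert space `L²(μ)`. -/
abbrev L2 (d : ℕ) (q : I) : Type := Lp ℝ 2 (mu d q)

/-- A local function depends on finitely many sites only. -/
def IsLocal (f : Config d → ℝ) : Prop := ∃ A : Finset (Site d), DependsOn f (A : Set (Site d))

/-! ## Kinetically constrained models and their generators -/

/-- The constraints of a kinetically constrained model on `ℤ^d`; `c x η = true` means that the
constraint at `x` is satisfied by `η`. -/
structure KCSM (d : ℕ) where
  /-- the constraints -/
  c : Site d → Config d → Bool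
  /-- translation invariance -/
  c_shift : ∀ (z x : Site d) (η : Config d), c x (shift z η) = c (z + x) η
  /-- `c x` depends on a fixed finite neighbourhood of `x` only -/
  finite_range : ∃ A : Finset (Site d), ∀ (x : Site d) (η η' : Config d),
    (∀ a ∈ A, η (x + a) = η' (x + a)) → c x η = c x η'
  /-- `c x` does not depend on the occupation variable at `x` -/
  c_flip : ∀ (x : Site d) (η : Config d), c x (flipAt x η) = c x η
  /-- the more zeros, the more constraints are satisfied -/
  c_antitone : ∀ η η' : Config d, (∀ x, η x ≤ η' x) → ∀ x, c x η' ≤ c x η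

/-- The rate `c_y(η) ((1-q)(1-η_y) + q η_y)` of the flip at `y`. -/
def KCSM.rate (K : KCSM d) (q : I) (y : Site d) (η : Config d) : ℝ :=
  (if K.c y η then 1 else 0) * ((1 - (q : ℝ)) * (1 - occ η y) + (q : ℝ) * occ η y)

/-- The generator `L_E` of the environment on local functions (for which the sum is finite). -/
def KCSM.envOp (K : KCSM d) (q : I) (f : Config d → ℝ) (η : Config d) : ℝ :=
  ∑' y : Site d, K.rate q y η * (f (flipAt y η) - f η)

/-- The part of the generator that comes from the jumps of the tracer: it jumps with rate one to
each neighbour, provided that both the site where it sits and the target site are empty. -/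
def jumpOp (f : Config d → ℝ) (η : Config d) : ℝ :=
  ∑ i : Fin d, ∑ α ∈ ({1, -1} : Finset ℤ),
    (1 - occ η 0) * (1 - occ η (α • unitVec i)) * (f (shift (α • unitVec i) η) - f η)

/-- The generator `L` of the environment seen from the tracer, on local functions. -/
def KCSM.tracerOp (K : KCSM d) (q : I) (f : Config d → ℝ) (η : Config d) : ℝ :=
  K.envOp q f η + jumpOp f η

/-- The graph in `L²(μ) × L²(μ)` of the closure of an operator given on local functions. -/
def closedGraph (q : I) (T : (Config d → ℝ) → Config d → ℝ) : Set (L2 d q × L2 d q) :=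
  closure {p | ∃ f : Config d → ℝ, IsLocal f ∧ p.1 =ᵐ[mu d q] f ∧ p.2 =ᵐ[mu d q] T f}

/-- The graph of the `L²(μ)` generator of the environment. -/
def KCSM.envGenerator (K : KCSM d) (q : I) : Set (L2 d q × L2 d q) := closedGraph q (K.envOp q)

/-- The graph of the `L²(μ)` generator of the environment seen from the tracer. -/
def KCSM.tracerGenerator (K : KCSM d) (q : I) : Set (L2 d q × L2 d q) :=
  closedGraph q (K.tracerOp q)

/-- The spectral gap of the environment: the infimum of `-μ(f L_E f) / Var_μ(f)` over all `f` in the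
domain of the `L²(μ)` generator that have non-zero variance. -/
def KCSM.gap (K : KCSM d) (q : I) : ℝ :=
  sInf {r | ∃ f g : L2 d q, (f, g) ∈ K.envGenerator q ∧
    ProbabilityTheory.variance f (mu d q) ≠ 0 ∧
    r = -(∫ η, f η * g η ∂(mu d q)) / ProbabilityTheory.variance f (mu d q)}

/-! ## Semigroups -/

/-- A strongly continuous contraction semigroup on a real normed space. -/
structure ContractionSemigroup (H : Type*) [NormedAddCommGroup H] [NormedSpace ℝ H] where
  /-- the operators -/
  op : ℝ≥0 → H →L[ℝ] H
  op_zero : op 0 = ContinuousLinearMap.id ℝ H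
  op_add : ∀ s t, op (s + t) = (op s).comp (op t)
  norm_op_le : ∀ t, ‖op t‖ ≤ 1
  continuous_op : ∀ f, Continuous fun t => op t f

/-- `S` has the generator with graph `G`: a pair `(f, g)` is in `G` if and only if
`(S_t f - f) / t → g` as `t → 0+`. A strongly continuous semigroup is determined by its generator. -/
def ContractionSemigroup.HasGenerator {H : Type*} [NormedAddCommGroup H] [NormedSpace ℝ H]
    (S : ContractionSemigroup H) (G : Set (H × H)) : Prop :=
  ∀ f g : H, (f, g) ∈ G ↔
    Tendsto (fun t : ℝ≥0 => (t : ℝ)⁻¹ • (S.op t f - f)) (𝓝[>] 0) (𝓝 g)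

open Classical in
/-- `e^{tG}`, for the graph `G` of the generator of a contraction semigroup
(zero if `G` generates none). -/
def expOp {H : Type*} [NormedAddCommGroup H] [NormedSpace ℝ H] (G : Set (H × H)) (t : ℝ≥0) :
    H →L[ℝ] H :=
  if h : ∃ S : ContractionSemigroup H, S.HasGenerator G then h.choose.op t else 0

/-! ## The diffusion matrix -/

/-- The current `j_u(η) = (1 - η_0) ∑_i ∑_{α = ±1} (1 - η_{α e_i}) α u_i`. -/
def current (u : Fin d → ℝ) (η : Config d) : ℝ :=
  (1 - occ η 0) * ∑ i : Fin d, ∑ α ∈ ({1, -1} : Finset ℤ),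
    (1 - occ η (α • unitVec i)) * (α : ℝ) * u i

theorem measurable_occ (x : Site d) : Measurable fun η : Config d => occ η x := by
  have h : Measurable fun b : Bool => if b then (1 : ℝ) else 0 := measurable_from_top
  exact h.comp (measurable_pi_apply x)

theorem occ_mem (η : Config d) (x : Site d) : 0 ≤ 1 - occ η x ∧ 1 - occ η x ≤ 1 := by
  unfold occ; split_ifs <;> norm_num

theorem memLp_current (q : I) (u : Fin d → ℝ) : MemLp (current u) 2 (mu d q) := by
  have hm : Measurable (current u) := by
    unfold current
    refine (measurable_const.sub (measurable_occ 0)).mul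
      (Finset.measurable_sum _ fun i _ => Finset.measurable_sum _ fun α _ => ?_)
    exact ((measurable_const.sub (measurable_occ _)).mul measurable_const).mul measurable_const
  refine MemLp.of_bound hm.aestronglyMeasurable
    (∑ i : Fin d, ∑ α ∈ ({1, -1} : Finset ℤ), |(α : ℝ)| * |u i|) (Eventually.of_forall fun η => ?_)
  have h0 := occ_mem η 0
  rw [current, Real.norm_eq_abs, abs_mul, abs_of_nonneg h0.1]
  refine (mul_le_of_le_one_left (abs_nonneg _) h0.2).trans ?_
  refine (Finset.abs_sum_le_sum_abs _ _).trans (Finset.sum_le_sum fun i _ => ?_)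
  refine (Finset.abs_sum_le_sum_abs _ _).trans (Finset.sum_le_sum fun α _ => ?_)
  have h1 := occ_mem η (α • unitVec i)
  rw [abs_mul, abs_mul, abs_of_nonneg h1.1]
  gcongr
  exact mul_le_of_le_one_left (abs_nonneg _) h1.2

/-- The time correlation `μ(j_u e^{tL} j_v)`. -/
def KCSM.corr (K : KCSM d) (q : I) (u v : Fin d → ℝ) (t : ℝ≥0) : ℝ :=
  ∫ η, current u η * expOp (K.tracerGenerator q) t (memLp_current q v).toLp η ∂(mu d q)

/-- The diffusion matrix
`D_{ik} = q² δ_{ik} - ∫_0^∞ μ(j_{e_i} e^{tL} j_{e_k}) dt`. -/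
def KCSM.diffusionMatrix (K : KCSM d) (q : I) : Matrix (Fin d) (Fin d) ℝ :=
  Matrix.of fun i k => (if i = k then (q : ℝ) ^ 2 else 0) -
    ∫ t in Set.Ioi (0 : ℝ), K.corr q (Pi.single i 1) (Pi.single k 1) t.toNNReal

end Tracer

end

noncomputable section

/-! ## Exponentials of bounded dissipative operators -/

section Dissipative

variable {H : Type*} [NormedAddCommGroup H] [InnerProductSpace ℝ H]

/-! The lower bound on `D` is an `H₋₁` estimate for the current. By detailed balance of the tracer
jumps, `μ(j_u f)` equals minus the sum over `i` of `u_i` times the mean of `jumpRate` times the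
increment of `f` across the bond `e_i`. Cauchy–Schwarz then gives `μ(j_u f)² ≤ q²‖u‖² E(f)`, where
`E` is the Dirichlet form of the jumps (`sq_integral_current_mul_le`). Alone this only yields `u·Du
≥ 0`. The gap improves it: `E(f) ≤ 4d Var(f)` because the jump rates are at most one, and `gap ·
Var(f)` is at most the Dirichlet form of the environment. Hence `(4d + gap) E(f) ≤ 4d (-μ(f L f))`,
which leads to `KCSM.sq_inner_current_le`.

This inequality is applied to `F_s = ∫_0^s e^{tL} j_u dt`, which lies in the domain with `L F_s =
e^{sL} j_u - j_u`. Write `J_s = ⟨j_u, F_s⟩`, the correlation integrated up to time `s`. Symmetry of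
the semigroup makes autocorrelations nonnegative, so `-⟨F_s, L F_s⟩ ≤ J_s`. Therefore `(4d + gap)
J_s² ≤ 4d q²‖u‖² J_s`, a bound on `J_s` uniform in `s` (`KCSM.integral_corr_le`). It gives
integrability and the lower bound together, without inverting `L` and without assuming a positive
gap. The upper bound is the sign of the autocorrelation, and polarization handles the matrix
entries.

The other half is that the closure of `L` from local functions really is a generator. By
Hille–Yosida it suffices that `l - L` has dense range on local functions for large `l`. For the
environment part, the equation is solved with only the sites of a finite set `S` active. The
dependence of the solution on far sites decays, so the neglected sites contribute little
(`KCSM.exists_approx_resolvent`). The jump part is bounded with norm at most `4d`, hence harmless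
when `l > 4d` (`KCSM.eq_zero_of_orthogonal_range`). -/

theorem exp_smul_apply_comm (A B : H →L[ℝ] H) (h : Commute A B) (t : ℝ) (f : H) :
    NormedSpace.exp (t • A) (B f) = B (NormedSpace.exp (t • A) f) := by
  have h1 : Commute (NormedSpace.exp (t • A)) B := (h.smul_left t).exp_left
  exact congrArg (fun T : H →L[ℝ] H => T f) h1.eq

variable [CompleteSpace H]

theorem hasDerivAt_exp_smul_apply (B : H →L[ℝ] H) (f : H) (t : ℝ) :
    HasDerivAt (fun s : ℝ => NormedSpace.exp (s • B) f) (NormedSpace.exp (t • B) (B f)) t := by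
  have h := (hasDerivAt_exp_smul_const B t).clm_apply (hasDerivAt_const t f)
  simpa using h

/-- The squared norm of the orbit has derivative `2⟨x, B x⟩ ≤ 0`. -/
theorem norm_exp_smul_apply_le (B : H →L[ℝ] H) (hB : ∀ f, inner ℝ f (B f) ≤ 0) {t : ℝ}
    (ht : 0 ≤ t) (f : H) : ‖NormedSpace.exp (t • B) f‖ ≤ ‖f‖ := by
  have hd : ∀ s : ℝ, HasDerivAt (fun s : ℝ => ‖NormedSpace.exp (s • B) f‖ ^ 2)
      (2 * inner ℝ (NormedSpace.exp (s • B) f) (NormedSpace.exp (s • B) (B f))) s := fun s =>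
    (hasDerivAt_exp_smul_apply B f s).norm_sq
  have ha : Antitone fun s : ℝ => ‖NormedSpace.exp (s • B) f‖ ^ 2 := by
    refine antitone_of_deriv_nonpos (fun s => (hd s).differentiableAt) fun s => ?_
    rw [(hd s).deriv, exp_smul_apply_comm B B (Commute.refl B)]
    linarith [hB (NormedSpace.exp (s • B) f)]
  have h := ha ht
  simp only [zero_smul, NormedSpace.exp_zero, one_apply_eq_self] at h
  exact (sq_le_sq₀ (norm_nonneg _) (norm_nonneg _)).1 h

theorem exp_add_of_commute_clm {A B : H →L[ℝ] H} (h : Commute A B) :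
    NormedSpace.exp (A + B) = NormedSpace.exp A * NormedSpace.exp B := by
  let _ : NormedAlgebra ℚ (H →L[ℝ] H) := NormedAlgebra.restrictScalars ℚ ℝ _
  exact NormedSpace.exp_add_of_commute h

theorem exp_add_smul (B : H →L[ℝ] H) (s t : ℝ) :
    NormedSpace.exp ((s + t) • B) = NormedSpace.exp (s • B) * NormedSpace.exp (t • B) := by
  rw [add_smul, exp_add_of_commute_clm]
  exact ((Commute.refl B).smul_left s).smul_right t

/-- Interpolate by `s ↦ exp(sA) exp((t - s)B) f`. By commutation its derivative is the same product
of contractions applied to `(A - B) f`. -/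
theorem norm_exp_smul_sub_exp_smul_le (A B : H →L[ℝ] H) (hAB : Commute A B)
    (hA : ∀ f, inner ℝ f (A f) ≤ 0) (hB : ∀ f, inner ℝ f (B f) ≤ 0) {t : ℝ} (ht : 0 ≤ t) (f : H) :
    ‖NormedSpace.exp (t • A) f - NormedSpace.exp (t • B) f‖ ≤ ‖A f - B f‖ * t := by
  have hd : ∀ s : ℝ, HasDerivAt
      (fun s : ℝ => NormedSpace.exp (s • (A - B)) (NormedSpace.exp (t • B) f))
      (NormedSpace.exp (s • (A - B)) ((A - B) (NormedSpace.exp (t • B) f))) s := fun s =>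
    hasDerivAt_exp_smul_apply (A - B) _ s
  have hsplit : ∀ s : ℝ, ∀ g, NormedSpace.exp (s • (A - B)) (NormedSpace.exp (t • B) g) =
      NormedSpace.exp (s • A) (NormedSpace.exp ((t - s) • B) g) := fun s g => by
    rw [← mul_apply_eq_comp, ← mul_apply_eq_comp,
      ← exp_add_of_commute_clm, ← exp_add_of_commute_clm]
    · congr 2
      module
    · exact (hAB.smul_left _).smul_right _
    · exact ((hAB.sub_left (Commute.refl B)).smul_left _).smul_right _
  have hb : ∀ s ∈ Set.Ico 0 t,
      ‖NormedSpace.exp (s • (A - B)) ((A - B) (NormedSpace.exp (t • B) f))‖ ≤ ‖A f - B f‖ := by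
    intro s hs
    rw [← exp_smul_apply_comm B (A - B) (hAB.symm.sub_right (Commute.refl B)), hsplit]
    exact (norm_exp_smul_apply_le A hA hs.1 _).trans
      (norm_exp_smul_apply_le B hB (sub_nonneg.2 hs.2.le) _)
  have h := norm_image_sub_le_of_norm_deriv_le_segment' (fun s _ => (hd s).hasDerivWithinAt) hb t
    ⟨ht, le_rfl⟩
  simpa [hsplit] using h

end Dissipative

/-! ## The Hille–Yosida theorem for dissipative graphs in a Hilbert space -/

theorem dense_norm_lt {H : Type*} [SeminormedAddCommGroup H] {D : Set H} (hD : Dense D)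
    (f : H) {ε : ℝ} (hε : 0 < ε) :
    ∃ g ∈ D, ‖f - g‖ < ε := by
  obtain ⟨g, hg, h⟩ := Metric.dense_iff.1 hD f ε hε
  exact ⟨g, h, by rwa [← dist_eq_norm, dist_comm, ← Metric.mem_ball]⟩

section HilleYosida

variable {H : Type*} [NormedAddCommGroup H] [InnerProductSpace ℝ H]

/-- Pair `l p.1 - p.2` with `p.1`: dissipativity bounds the result below by `l ‖p.1‖²`,
Cauchy–Schwarz above. This gives injectivity of `l - G`, the resolvent bound `1/l`, and closedness
of the range. -/
theorem norm_le_norm_smul_sub {p : H × H} (hp : inner ℝ p.1 p.2 ≤ 0) (l : ℝ) :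
    l * ‖p.1‖ ≤ ‖l • p.1 - p.2‖ := by
  have h1 : l * ‖p.1‖ ^ 2 ≤ ‖p.1‖ * ‖l • p.1 - p.2‖ := by
    have h2 := real_inner_le_norm p.1 (l • p.1 - p.2)
    rw [inner_sub_right, inner_smul_right, real_inner_self_eq_norm_sq] at h2
    linarith
  rcases (norm_nonneg p.1).eq_or_lt with h0 | h0
  · simp [← h0]
  · nlinarith

theorem eq_of_smul_sub_eq {G : Submodule ℝ (H × H)} (hd : ∀ p ∈ G, inner ℝ p.1 p.2 ≤ 0) {l : ℝ}
    (hl : 0 < l) {p p' : H × H} (hp : p ∈ G) (hp' : p' ∈ G)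
    (h : l • p.1 - p.2 = l • p'.1 - p'.2) : p.1 = p'.1 := by
  have h1 := norm_le_norm_smul_sub (hd _ (G.sub_mem hp hp')) l
  have h2 : l • (p - p').1 - (p - p').2 = 0 := by
    simp only [Prod.fst_sub, Prod.snd_sub, smul_sub]
    rw [sub_eq_zero]
    have := sub_eq_zero.2 h
    rw [← sub_eq_zero, ← this]; abel
  rw [h2, norm_zero] at h1
  have h3 : ‖(p - p').1‖ = 0 := le_antisymm (by nlinarith) (norm_nonneg _)
  simpa [sub_eq_zero] using h3

theorem exists_resolvent {G : Submodule ℝ (H × H)} (hd : ∀ p ∈ G, inner ℝ p.1 p.2 ≤ 0) {l : ℝ}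
    (hl : 0 < l) (hs : ∀ h : H, ∃ p ∈ G, l • p.1 - p.2 = h) :
    ∃ R : H →L[ℝ] H, (∀ h, (R h, l • R h - h) ∈ G) ∧ ∀ p ∈ G, R (l • p.1 - p.2) = p.1 := by
  choose P hP hPe using hs
  have hmem : ∀ h, ((P h).1, l • (P h).1 - h) ∈ G := fun h => by
    have : l • (P h).1 - h = (P h).2 := by
      rw [sub_eq_iff_eq_add, add_comm, ← sub_eq_iff_eq_add, hPe]
    rw [this]; exact hP h
  have huniq : ∀ p ∈ G, (P (l • p.1 - p.2)).1 = p.1 := fun p hp =>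
    eq_of_smul_sub_eq hd hl (hP _) hp (hPe _)
  let R : H →ₗ[ℝ] H :=
    { toFun := fun h => (P h).1
      map_add' := fun a b => by
        have h := huniq _ (G.add_mem (hP a) (hP b))
        rw [Prod.fst_add, Prod.snd_add, smul_add, add_sub_add_comm, hPe, hPe] at h
        exact h
      map_smul' := fun c a => by
        have h := huniq _ (G.smul_mem c (hP a))
        rw [Prod.smul_fst, Prod.smul_snd, smul_comm, ← smul_sub, hPe] at h
        exact h }
  refine ⟨R.mkContinuous l⁻¹ fun h => ?_, hmem, huniq⟩
  have h1 := norm_le_norm_smul_sub (hd _ (hP h)) l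
  rw [hPe] at h1
  rw [inv_mul_eq_div, le_div_iff₀' hl]
  exact h1

variable [CompleteSpace H]

open Tracer in
/-- Hille–Yosida: a dissipative operator with dense domain such that `l - G` is onto for all `l`
in a sequence tending to infinity generates a contraction semigroup. -/
theorem exists_contractionSemigroup {G : Submodule ℝ (H × H)}
    (hd : ∀ p ∈ G, inner ℝ p.1 p.2 ≤ 0) (hdense : Dense {f | ∃ g, (f, g) ∈ G}) {l₀ : ℝ}
    (hl₀ : 0 < l₀) (hs : ∀ l ≥ l₀, ∀ h : H, ∃ p ∈ G, l • p.1 - p.2 = h) :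
    ∃ S : ContractionSemigroup H, S.HasGenerator (G : Set (H × H)) := by
  have hlpos : ∀ n : ℕ, 0 < (n : ℝ) + l₀ := fun n => by positivity
  choose R hR hRl using fun n : ℕ => exists_resolvent hd (hlpos n) (hs (n + l₀) (by simp))
  -- Yosida approximations: bounded, dissipative, mutually commuting, and convergent to the
  -- generator on its domain.
  set B : ℕ → H →L[ℝ] H := fun n =>
    ((n : ℝ) + l₀) • (((n : ℝ) + l₀) • R n - ContinuousLinearMap.id ℝ H) with hB
  have hBapp : ∀ n f, B n f = ((n : ℝ) + l₀) • (((n : ℝ) + l₀) • R n f - f) := fun n f => rfl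
  have hdiss : ∀ n f, inner ℝ f (B n f) ≤ 0 := fun n f => by
    have h1 := hd _ (hR n f)
    set g := ((n : ℝ) + l₀) • R n f - f with hg
    have hf : f = ((n : ℝ) + l₀) • R n f - g := by rw [hg]; abel
    rw [hBapp, ← hg, inner_smul_right]
    -- Since `(R_n f, g) ∈ G`, the first term is nonpositive, and so is the whole.
    have h2 : inner ℝ f g = ((n : ℝ) + l₀) * inner ℝ (R n f) g - ‖g‖ ^ 2 := by
      conv_lhs => rw [hf]
      rw [inner_sub_left, real_inner_smul_left, real_inner_self_eq_norm_sq]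
    have h1' : inner ℝ (R n f) g ≤ 0 := h1
    rw [h2]
    have := hlpos n
    exact mul_nonpos_of_nonneg_of_nonpos this.le
      (by nlinarith [sq_nonneg ‖g‖, mul_nonneg this.le (neg_nonneg.2 h1')])
  have hRnorm : ∀ (n : ℕ) f, ((n : ℝ) + l₀) * ‖R n f‖ ≤ ‖f‖ := fun n f => by
    have h := norm_le_norm_smul_sub (hd _ (hR n f)) (n + l₀)
    simpa using h
  have hBG : ∀ n, ∀ p ∈ G, B n p.1 = ((n : ℝ) + l₀) • R n p.2 := fun n p hp => by
    have h := hRl n p hp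
    rw [map_sub, map_smul] at h
    rw [hBapp]
    congr 1
    nth_rw 2 [← h]
    abel
  have hRcomm : ∀ m n, Commute (R m) (R n) := fun m n => by
    rcases eq_or_ne m n with rfl | hmn
    · exact Commute.refl _
    -- The resolvent identity. Exchanging `m` and `n` and comparing yields commutation, since `m - n
    -- ≠ 0`.
    have key : ∀ m n : ℕ, ∀ h, R n h = R m h + ((m : ℝ) - n) • R m (R n h) := fun m n h => by
      have h1 := hRl m _ (hR n h)
      have h2 : ((m : ℝ) + l₀) • R n h - (((n : ℝ) + l₀) • R n h - h) =
          h + ((m : ℝ) - n) • R n h := by module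
      simp only at h1
      rw [h2, map_add, map_smul] at h1
      exact h1.symm
    have hne : (m : ℝ) - n ≠ 0 := sub_ne_zero.2 (by exact_mod_cast hmn)
    refine ContinuousLinearMap.ext fun h => ?_
    change R m (R n h) = R n (R m h)
    have e1 := key m n h
    have e2 := key n m h
    have e3 : ((m : ℝ) - n) • (R m (R n h) - R n (R m h)) = 0 := by
      have a1 : ((m : ℝ) - n) • R m (R n h) = R n h - R m h := by
        rw [eq_sub_iff_add_eq, add_comm]; exact e1.symm
      have a2 : ((n : ℝ) - m) • R n (R m h) = R m h - R n h := by
        rw [eq_sub_iff_add_eq, add_comm]; exact e2.symm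
      have a3 : ((m : ℝ) - n) • R n (R m h) = R n h - R m h := by
        rw [← neg_sub (n : ℝ) m, neg_smul, a2, neg_sub]
      rw [smul_sub, a1, a3, sub_self]
    exact sub_eq_zero.1 ((smul_eq_zero.1 e3).resolve_left hne)
  have hBcomm : ∀ m n, Commute (B m) (B n) := fun m n => by
    have hid : ∀ T : H →L[ℝ] H, Commute (ContinuousLinearMap.id ℝ H) T := Commute.one_left
    refine Commute.smul_left (Commute.smul_right ?_ _) _
    exact Commute.sub_left (Commute.sub_right (((hRcomm m n).smul_left _).smul_right _)
      (hid _).symm) (hid _)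
  have hRlim : ∀ f, Tendsto (fun n : ℕ => ((n : ℝ) + l₀) • R n f) atTop (𝓝 f) := by
    intro f
    rw [Metric.tendsto_atTop]
    intro ε hε
    obtain ⟨g, ⟨g', hg⟩, hfg⟩ := dense_norm_lt hdense f (show (0 : ℝ) < ε / 3 by positivity)
    obtain ⟨N, hN⟩ := exists_nat_gt (3 * ‖g'‖ / ε)
    refine ⟨N, fun n hn => ?_⟩
    have h1 : ((n : ℝ) + l₀) • R n g - g = R n g' := by
      have := hRl n _ hg
      simp only [map_sub, map_smul] at this
      nth_rw 2 [← this]; abel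
    have h2 : ‖R n g'‖ < ε / 3 := by
      have h3 := hRnorm n g'
      have h4 : 3 * ‖g'‖ / ε < (n : ℝ) + l₀ := by
        have : (N : ℝ) ≤ n := by exact_mod_cast hn
        linarith
      rw [div_lt_iff₀ hε] at h4
      have := hlpos n
      by_contra! hc
      nlinarith
    have h5 : ‖((n : ℝ) + l₀) • R n (f - g)‖ < ε / 3 := by
      rw [norm_smul, Real.norm_of_nonneg (hlpos n).le]
      exact (hRnorm n _).trans_lt hfg
    have e : ((n : ℝ) + l₀) • R n f - f =
        ((n : ℝ) + l₀) • R n (f - g) + R n g' - (f - g) := by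
      rw [← h1, map_sub, smul_sub]; abel
    rw [dist_eq_norm, e]
    calc _ ≤ ‖((n : ℝ) + l₀) • R n (f - g)‖ + ‖R n g'‖ + ‖f - g‖ :=
          (norm_sub_le _ _).trans (by gcongr; exact norm_add_le _ _)
      _ < ε := by linarith
  have hBlim : ∀ p ∈ G, Tendsto (fun n => B n p.1) atTop (𝓝 p.2) := fun p hp => by
    simp_rw [fun n => hBG n p hp]
    exact hRlim p.2
  have hcontr : ∀ n (t : ℝ≥0) f, ‖NormedSpace.exp ((t : ℝ) • B n) f‖ ≤ ‖f‖ := fun n t f =>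
    norm_exp_smul_apply_le _ (hdiss n) t.2 f
  -- On the domain `B n f` converges, so the approximate semigroups are Cauchy, uniformly for
  -- bounded `t`; contractivity and density extend the convergence to all `f`.
  have hcauchyD : ∀ m n (t : ℝ≥0) f, ‖NormedSpace.exp ((t : ℝ) • B m) f -
      NormedSpace.exp ((t : ℝ) • B n) f‖ ≤ ‖B m f - B n f‖ * t := fun m n t f =>
    norm_exp_smul_sub_exp_smul_le _ _ (hBcomm m n) (hdiss m) (hdiss n) t.2 f
  have hcauchy : ∀ (t : ℝ≥0) f, CauchySeq fun n => NormedSpace.exp ((t : ℝ) • B n) f := by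
    intro t f
    rw [Metric.cauchySeq_iff]
    intro ε hε
    obtain ⟨g, ⟨g', hg⟩, hfg⟩ := dense_norm_lt hdense f (show (0 : ℝ) < ε / 3 by positivity)
    obtain ⟨N, hN⟩ := Metric.cauchySeq_iff.1 (hBlim _ hg).cauchySeq (ε / (3 * (t + 1)))
      (by positivity)
    refine ⟨N, fun m hm n hn => ?_⟩
    have h1 : ‖B m g - B n g‖ * t < ε / 3 := by
      have h2 := hN m hm n hn
      rw [dist_eq_norm] at h2
      have ht : (0 : ℝ) ≤ t := t.2
      rw [lt_div_iff₀ (by positivity)] at h2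
      nlinarith [norm_nonneg (B m g - B n g)]
    have e : NormedSpace.exp ((t : ℝ) • B m) f - NormedSpace.exp ((t : ℝ) • B n) f =
        NormedSpace.exp ((t : ℝ) • B m) (f - g) +
        (NormedSpace.exp ((t : ℝ) • B m) g - NormedSpace.exp ((t : ℝ) • B n) g) -
        NormedSpace.exp ((t : ℝ) • B n) (f - g) := by
      rw [map_sub, map_sub]; abel
    rw [dist_eq_norm, e]
    calc _ ≤ ‖NormedSpace.exp ((t : ℝ) • B m) (f - g)‖ +
          ‖NormedSpace.exp ((t : ℝ) • B m) g - NormedSpace.exp ((t : ℝ) • B n) g‖ +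
          ‖NormedSpace.exp ((t : ℝ) • B n) (f - g)‖ :=
          (norm_sub_le _ _).trans (by gcongr; exact norm_add_le _ _)
      _ < ε := by linarith [hcontr m t (f - g), hcontr n t (f - g), hcauchyD m n t g]
  choose T hT using fun t f => cauchySeq_tendsto_of_complete (hcauchy t f)
  have hTnorm : ∀ t f, ‖T t f‖ ≤ ‖f‖ := fun t f =>
    le_of_tendsto (hT t f).norm (Eventually.of_forall fun n => hcontr n t f)
  have hTadd : ∀ t f g, T t (f + g) = T t f + T t g := fun t f g =>
    tendsto_nhds_unique (hT t (f + g)) (by simpa using (hT t f).add (hT t g))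
  have hTsmul : ∀ t (c : ℝ) f, T t (c • f) = c • T t f := fun t c f =>
    tendsto_nhds_unique (hT t (c • f)) (by simpa using (hT t f).const_smul c)
  let S : ℝ≥0 → H →L[ℝ] H := fun t => LinearMap.mkContinuous
    { toFun := T t, map_add' := hTadd t, map_smul' := hTsmul t } 1
    fun f => by simpa using hTnorm t f
  have hS : ∀ (t : ℝ≥0) f, Tendsto (fun n => NormedSpace.exp ((t : ℝ) • B n) f) atTop (𝓝 (S t f)) := hT
  have hSnorm : ∀ t f, ‖S t f‖ ≤ ‖f‖ := hTnorm
  have happrox : ∀ (n : ℕ) (t : ℝ≥0), ∀ p ∈ G, ‖S t p.1 - NormedSpace.exp ((t : ℝ) • B n) p.1‖ ≤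
      ‖p.2 - B n p.1‖ * t := fun n t p hp =>
    le_of_tendsto_of_tendsto ((hS t p.1).sub_const _).norm
      (((hBlim p hp).sub_const _).norm.mul_const _)
      (Eventually.of_forall fun m => hcauchyD m n t p.1)
  have hcontD : ∀ p ∈ G, Continuous fun t : ℝ≥0 => S t p.1 := by
    intro p hp
    rw [continuous_iff_continuousAt]
    intro t₀
    refine continuousAt_of_locally_uniform_approx_of_continuousAt fun u hu => ?_
    obtain ⟨ε, hε, hεu⟩ := Metric.mem_uniformity_dist.1 hu
    obtain ⟨N, hN⟩ := Metric.tendsto_atTop.1 (hBlim p hp) (ε / (t₀ + 1)) (by positivity)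
    refine ⟨Set.Iio (t₀ + 1), Iio_mem_nhds (by simp),
      fun t : ℝ≥0 => NormedSpace.exp ((t : ℝ) • B N) p.1, ?_, fun t ht => hεu ?_⟩
    · have : Continuous fun t : ℝ => NormedSpace.exp (t • B N) p.1 :=
        continuous_iff_continuousAt.2 fun t => (hasDerivAt_exp_smul_apply (B N) p.1 t).continuousAt
      exact (this.comp NNReal.continuous_coe).continuousAt
    · rw [dist_eq_norm]
      refine (happrox N t p hp).trans_lt ?_
      have h1 := hN N le_rfl
      rw [dist_comm, dist_eq_norm, lt_div_iff₀ (by positivity)] at h1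
      have h2 : (t : ℝ) < t₀ + 1 := by exact_mod_cast ht
      refine lt_of_le_of_lt ?_ h1
      gcongr
  have hcont : ∀ f, Continuous fun t : ℝ≥0 => S t f := by
    intro f
    rw [continuous_iff_continuousAt]
    intro t₀
    refine continuousAt_of_locally_uniform_approx_of_continuousAt fun u hu => ?_
    obtain ⟨ε, hε, hεu⟩ := Metric.mem_uniformity_dist.1 hu
    obtain ⟨g, ⟨g', hg⟩, hfg⟩ := dense_norm_lt hdense f hε
    refine ⟨Set.univ, univ_mem, fun t => S t g, (hcontD _ hg).continuousAt, fun t _ => hεu ?_⟩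
    rw [dist_eq_norm, ← map_sub]
    exact (hSnorm t _).trans_lt hfg
  let S' : ContractionSemigroup H :=
    { op := S
      op_zero := ContinuousLinearMap.ext fun f =>
        tendsto_nhds_unique (hS 0 f) (by simp)
      op_add := fun s t => ContinuousLinearMap.ext fun f => by
        refine tendsto_nhds_unique (hS (s + t) f) ?_
        have e : ∀ n, NormedSpace.exp (((s + t : ℝ≥0) : ℝ) • B n) f =
            NormedSpace.exp ((s : ℝ) • B n) (NormedSpace.exp ((t : ℝ) • B n) f - S t f) +
            NormedSpace.exp ((s : ℝ) • B n) (S t f) := fun n => by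
          rw [NNReal.coe_add, exp_add_smul, map_sub, mul_apply_eq_comp]; abel
        simp_rw [e]
        have h0 : Tendsto (fun n => NormedSpace.exp ((s : ℝ) • B n)
            (NormedSpace.exp ((t : ℝ) • B n) f - S t f)) atTop (𝓝 0) := by
          refine squeeze_zero_norm (fun n => hcontr n s _) ?_
          simpa using ((hS t f).sub_const (S t f)).norm
        simpa using h0.add (hS s (S t f))
      norm_op_le := fun t => ContinuousLinearMap.opNorm_le_bound _ zero_le_one
        fun f => by simpa using hSnorm t f
      continuous_op := hcont }
  have hgen : ∀ p ∈ G, Tendsto (fun t : ℝ≥0 => (t : ℝ)⁻¹ • (S t p.1 - p.1)) (𝓝[>] 0)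
      (𝓝 p.2) := by
    intro p hp
    rw [Metric.tendsto_nhds]
    intro ε hε
    obtain ⟨N, hN⟩ := Metric.tendsto_atTop.1 (hBlim p hp) (ε / 3) (by positivity)
    have hN := hN N le_rfl
    rw [dist_comm, dist_eq_norm] at hN
    have hder : Tendsto (fun t : ℝ≥0 => (t : ℝ)⁻¹ • (NormedSpace.exp ((t : ℝ) • B N) p.1 - p.1))
        (𝓝[>] 0) (𝓝 (B N p.1)) := by
      have h := (hasDerivAt_exp_smul_apply (B N) p.1 0).tendsto_slope_zero_right
      simp only [zero_smul, NormedSpace.exp_zero, one_apply_eq_self, zero_add] at h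
      refine h.comp (tendsto_nhdsWithin_iff.2 ⟨?_, ?_⟩)
      · exact (NNReal.continuous_coe.tendsto' 0 0 rfl).mono_left nhdsWithin_le_nhds
      · exact eventually_nhdsWithin_of_forall fun t ht => by simpa using ht
    filter_upwards [Metric.tendsto_nhds.1 hder (ε / 3) (by positivity), self_mem_nhdsWithin]
      with t ht htpos
    have htpos : (0 : ℝ) < t := by exact_mod_cast htpos
    have h1 : ‖(t : ℝ)⁻¹ • (S t p.1 - NormedSpace.exp ((t : ℝ) • B N) p.1)‖ ≤
        ‖p.2 - B N p.1‖ := by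
      rw [norm_smul, norm_inv, Real.norm_of_nonneg htpos.le, inv_mul_le_iff₀ htpos, mul_comm]
      exact happrox N t p hp
    rw [dist_eq_norm] at ht ⊢
    have e : (t : ℝ)⁻¹ • (S t p.1 - p.1) - p.2 =
        (t : ℝ)⁻¹ • (S t p.1 - NormedSpace.exp ((t : ℝ) • B N) p.1) +
        ((t : ℝ)⁻¹ • (NormedSpace.exp ((t : ℝ) • B N) p.1 - p.1) - B N p.1) -
        (p.2 - B N p.1) := by module
    rw [e]
    calc _ ≤ ‖(t : ℝ)⁻¹ • (S t p.1 - NormedSpace.exp ((t : ℝ) • B N) p.1)‖ +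
          ‖(t : ℝ)⁻¹ • (NormedSpace.exp ((t : ℝ) • B N) p.1 - p.1) - B N p.1‖ +
          ‖p.2 - B N p.1‖ := (norm_sub_le _ _).trans (by gcongr; exact norm_add_le _ _)
      _ < ε := by linarith
  refine ⟨S', fun f g => ⟨fun h => hgen _ h, fun h => ?_⟩⟩
  have h : Tendsto (fun t : ℝ≥0 => (t : ℝ)⁻¹ • (S t f - f)) (𝓝[>] 0) (𝓝 g) := h
  -- Maximality of `G`: choose `p ∈ G` with the same image as `(f, g)` under `l₀ - ·`. The
  -- difference is dissipative, because the semigroup contracts, and is killed by `l₀ - ·`, so it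
  -- vanishes.
  obtain ⟨p, hp, hpe⟩ := hs l₀ le_rfl (l₀ • f - g)
  have hp' := hgen p hp
  have hdiff : Tendsto (fun t : ℝ≥0 => (t : ℝ)⁻¹ • (S t (f - p.1) - (f - p.1))) (𝓝[>] 0)
      (𝓝 (g - p.2)) := by
    refine (h.sub hp').congr fun t => ?_
    rw [← smul_sub, map_sub]; congr 1; abel
  have hneg : inner ℝ (f - p.1) (g - p.2) ≤ 0 := by
    refine le_of_tendsto ((tendsto_const_nhds (x := f - p.1)).inner hdiff)
      (eventually_nhdsWithin_of_forall fun t ht => ?_)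
    rw [inner_smul_right, inner_sub_right, real_inner_self_eq_norm_sq]
    refine mul_nonpos_of_nonneg_of_nonpos (by positivity) ?_
    have h1 := real_inner_le_norm (f - p.1) (S t (f - p.1))
    nlinarith [hSnorm t (f - p.1), norm_nonneg (f - p.1)]
  have h0 := norm_le_norm_smul_sub (p := (f - p.1, g - p.2)) hneg l₀
  have e0 : l₀ • (f - p.1) - (g - p.2) = 0 := by
    have : l₀ • (f - p.1) - (g - p.2) = (l₀ • f - g) - (l₀ • p.1 - p.2) := by module
    rw [this, hpe, sub_self]
  simp only at h0
  rw [e0, norm_zero] at h0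
  have hf : f = p.1 := by
    have : ‖f - p.1‖ = 0 := le_antisymm (by nlinarith) (norm_nonneg _)
    simpa [sub_eq_zero] using this
  have hg : g = p.2 := by
    rw [hf, sub_self, smul_zero, zero_sub, neg_eq_zero, sub_eq_zero] at e0
    exact e0
  rw [hf, hg]
  exact hp

end HilleYosida

/-! ## Contraction semigroups with a given generator -/

namespace Tracer

variable {H : Type*} [NormedAddCommGroup H] [NormedSpace ℝ H]

theorem ContractionSemigroup.continuous_op_toNNReal (S : ContractionSemigroup H) (f : H) :
    Continuous fun t : ℝ => S.op t.toNNReal f :=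
  (S.continuous_op f).comp continuous_real_toNNReal

theorem ContractionSemigroup.op_add_apply (S : ContractionSemigroup H) (s t : ℝ≥0) (f : H) :
    S.op (s + t) f = S.op s (S.op t f) := by
  rw [S.op_add]; rfl

theorem tendsto_toNNReal_nhdsGT_zero : Tendsto Real.toNNReal (𝓝[>] 0) (𝓝[>] 0) := by
  refine tendsto_nhdsWithin_iff.2 ⟨?_, eventually_nhdsWithin_of_forall fun t ht => ?_⟩
  · exact (continuous_real_toNNReal.tendsto' 0 0 (by simp)).mono_left nhdsWithin_le_nhds
  · simpa using ht

theorem tendsto_coe_nhdsGT_zero : Tendsto ((↑) : ℝ≥0 → ℝ) (𝓝[>] 0) (𝓝[>] 0) := by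
  refine tendsto_nhdsWithin_iff.2 ⟨?_, eventually_nhdsWithin_of_forall fun t ht => ?_⟩
  · exact (NNReal.continuous_coe.tendsto' 0 0 rfl).mono_left nhdsWithin_le_nhds
  · simpa using ht

variable {S : ContractionSemigroup H} {G : Set (H × H)}

theorem ContractionSemigroup.HasGenerator.op_mem (hS : S.HasGenerator G) {f g : H}
    (h : (f, g) ∈ G) (s : ℝ≥0) : (S.op s f, S.op s g) ∈ G := by
  rw [hS]
  refine (((S.op s).continuous.tendsto g).comp ((hS f g).1 h)).congr fun t => ?_
  simp only [Function.comp_apply, map_smul, map_sub]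
  rw [← S.op_add_apply, ← S.op_add_apply, add_comm]

theorem ContractionSemigroup.HasGenerator.hasDerivWithinAt (hS : S.HasGenerator G) {f g : H}
    (h : (f, g) ∈ G) {s : ℝ} (hs : 0 ≤ s) :
    HasDerivWithinAt (fun t : ℝ => S.op t.toNNReal f) (S.op s.toNNReal g) (Set.Ioi s) s := by
  rw [hasDerivWithinAt_iff_tendsto_slope' (by simp)]
  have h1 := ((hS _ _).1 (hS.op_mem h s.toNNReal)).comp tendsto_toNNReal_nhdsGT_zero
  have h2 : Tendsto (fun t : ℝ => t - s) (𝓝[>] s) (𝓝[>] 0) := by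
    refine tendsto_nhdsWithin_iff.2 ⟨?_, eventually_nhdsWithin_of_forall fun t ht => ?_⟩
    · exact (((continuous_id.sub continuous_const).tendsto' s 0 (sub_self s)).mono_left
        nhdsWithin_le_nhds : Tendsto (fun t : ℝ => id t - s) (𝓝[>] s) (𝓝 0))
    · simpa using ht
  refine (h1.comp h2).congr' (eventually_nhdsWithin_of_forall fun t ht => ?_)
  have ht : s < t := ht
  simp only [Function.comp_apply, slope_def_module]
  rw [Real.coe_toNNReal _ (sub_nonneg.2 ht.le), ← S.op_add_apply,
    ← Real.toNNReal_add (sub_nonneg.2 ht.le) hs, sub_add_cancel]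

variable [CompleteSpace H]

/-- The fundamental theorem of calculus needs only the right derivative, which is all that the
definition of the generator supplies. Differentiating this integral then upgrades it to a two-sided
derivative. -/
theorem ContractionSemigroup.HasGenerator.integral_eq_sub (hS : S.HasGenerator G) {f g : H}
    (h : (f, g) ∈ G) {s : ℝ} (hs : 0 ≤ s) :
    ∫ t in (0 : ℝ)..s, S.op t.toNNReal g = S.op s.toNNReal f - f := by
  have := intervalIntegral.integral_eq_sub_of_hasDeriv_right_of_le hs
    (S.continuous_op_toNNReal f).continuousOn (fun t ht => hS.hasDerivWithinAt h ht.1.le)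
    ((S.continuous_op_toNNReal g).intervalIntegrable _ _)
  simpa [S.op_zero] using this

theorem ContractionSemigroup.HasGenerator.hasDerivAt (hS : S.HasGenerator G) {f g : H}
    (h : (f, g) ∈ G) {s : ℝ} (hs : 0 < s) :
    HasDerivAt (fun t : ℝ => S.op t.toNNReal f) (S.op s.toNNReal g) s := by
  have h1 : HasDerivAt (fun s : ℝ => f + ∫ t in (0 : ℝ)..s, S.op t.toNNReal g)
      (S.op s.toNNReal g) s :=
    ((S.continuous_op_toNNReal g).integral_hasStrictDerivAt 0 s).hasDerivAt.const_add f
  refine h1.congr_of_eventuallyEq ?_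
  filter_upwards [lt_mem_nhds hs] with t ht
  rw [hS.integral_eq_sub h ht.le]; abel

/-- The time integral of an orbit of the semigroup belongs to the domain of the generator. -/
theorem ContractionSemigroup.HasGenerator.integral_mem (hS : S.HasGenerator G) (f : H)
    {s : ℝ} (hs : 0 ≤ s) :
    (∫ t in (0 : ℝ)..s, S.op t.toNNReal f, S.op s.toNNReal f - f) ∈ G := by
  set F : ℝ → H := fun x => ∫ t in (0 : ℝ)..x, S.op t.toNNReal f with hF
  have hd : ∀ x, HasDerivAt F (S.op x.toNNReal f) x := fun x =>
    ((S.continuous_op_toNNReal f).integral_hasStrictDerivAt 0 x).hasDerivAt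
  have hint : ∀ a b : ℝ, IntervalIntegrable (fun t : ℝ => S.op t.toNNReal f) volume a b := fun a b =>
    (S.continuous_op_toNNReal f).intervalIntegrable a b
  rw [hS]
  -- By the semigroup law `S_t F(s) - F(s) = (F(s+t) - F(s)) - (F(t) - F(0))`, so the generator
  -- quotient is a difference of two slopes of `F`.
  have h1 := ((hd s).tendsto_slope_zero_right.sub (hd 0).tendsto_slope_zero_right).comp
    tendsto_coe_nhdsGT_zero
  simp only [Real.toNNReal_zero, S.op_zero, ContinuousLinearMap.id_apply] at h1
  refine h1.congr fun t => ?_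
  simp only [Function.comp_apply]
  rw [← smul_sub]
  congr 1
  have h2 : S.op t (F s) = F (s + t) - F t := by
    simp only [hF]
    rw [← ContinuousLinearMap.intervalIntegral_comp_comm _ (hint 0 s),
      intervalIntegral.integral_interval_sub_left (hint _ _) (hint _ _)]
    have h3 : ∫ x in (0 : ℝ)..s, S.op t (S.op x.toNNReal f) =
        ∫ x in (0 : ℝ)..s, S.op (x + t).toNNReal f := by
      refine intervalIntegral.integral_congr fun x hx => ?_
      rw [Set.uIcc_of_le hs] at hx
      rw [← S.op_add_apply, Real.toNNReal_add hx.1 t.coe_nonneg, Real.toNNReal_coe, add_comm]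
    rw [h3, intervalIntegral.integral_comp_add_right (fun x : ℝ => S.op x.toNNReal f)]
    simp
  change _ = S.op t (F s) - F s
  rw [h2, zero_add]
  have : F 0 = 0 := by simp [hF]
  rw [this]; abel

end Tracer

/-! ### Symmetric generators -/

namespace Tracer

variable {H : Type*} [NormedAddCommGroup H] [InnerProductSpace ℝ H] [CompleteSpace H]
variable {S : ContractionSemigroup H} {G : Set (H × H)}

/-- A semigroup whose generator is symmetric consists of symmetric operators. -/
theorem ContractionSemigroup.HasGenerator.inner_op_left (hS : S.HasGenerator G)
    (hsymm : ∀ p ∈ G, ∀ p' ∈ G, inner ℝ p.2 p'.1 = inner ℝ p.1 p'.2)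
    (hdense : Dense {f | ∃ g, (f, g) ∈ G}) (t : ℝ≥0) (f h : H) :
    inner ℝ (S.op t f) h = inner ℝ f (S.op t h) := by
  have hD : ∀ f ∈ {f | ∃ g, (f, g) ∈ G}, ∀ h ∈ {f | ∃ g, (f, g) ∈ G},
      inner ℝ (S.op t f) h = inner ℝ f (S.op t h) := by
    rintro f ⟨f', hf⟩ h ⟨h', hh⟩
    -- The function `s ↦ ⟨S_s f, S_{t-s} h⟩` interpolates between the two sides and is constant: the
    -- two terms of its derivative cancel by symmetry of the generator.
    have hcont : ContinuousOn (fun s : ℝ => inner ℝ (S.op s.toNNReal f)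
        (S.op ((t : ℝ) - s).toNNReal h)) (Set.Icc 0 (t : ℝ)) :=
      ((S.continuous_op_toNNReal f).inner ((S.continuous_op_toNNReal h).comp
        (continuous_const.sub continuous_id))).continuousOn
    have hder : ∀ s ∈ Set.Ioo 0 (t : ℝ), HasDerivAt (fun s : ℝ => inner ℝ (S.op s.toNNReal f)
        (S.op ((t : ℝ) - s).toNNReal h)) 0 s := by
      intro s hs
      have h1 := hS.hasDerivAt hf hs.1
      have h2 := (hS.hasDerivAt hh (sub_pos.2 hs.2)).scomp s ((hasDerivAt_id s).const_sub (t : ℝ))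
      have h3 := h1.inner ℝ h2
      have h4 := hsymm _ (hS.op_mem hf s.toNNReal) _ (hS.op_mem hh ((t : ℝ) - s).toNNReal)
      simp only at h4
      have h5 : inner ℝ (S.op s.toNNReal f) ((-1 : ℝ) • S.op ((t : ℝ) - s).toNNReal h') +
          inner ℝ (S.op s.toNNReal f') (S.op ((t : ℝ) - s).toNNReal h) = 0 := by
        rw [h4, neg_one_smul, inner_neg_right, neg_add_cancel]
      rw [← h5]
      exact h3
    have h5 := intervalIntegral.integral_eq_sub_of_hasDerivAt_of_le t.2 hcont hder
      intervalIntegrable_const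
    simp only [intervalIntegral.integral_zero] at h5
    simpa [S.op_zero, sub_eq_zero] using h5.symm
  have h1 : ∀ f ∈ {f | ∃ g, (f, g) ∈ G}, ∀ h, inner ℝ (S.op t f) h = inner ℝ f (S.op t h) :=
    fun f hf h => congrFun (Continuous.ext_on hdense (by fun_prop) (by fun_prop)
      fun h hh => hD f hf h hh) h
  exact congrFun (Continuous.ext_on hdense (by fun_prop) (by fun_prop)
      fun f hf => h1 f hf h) f

end Tracer

/-! ## Local functions -/

namespace Tracer

variable {d : ℕ}

theorem exists_eq_comp_of_dependsOn {f : Config d → ℝ} {A : Finset (Site d)}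
    (hf : DependsOn f (A : Set (Site d))) :
    ∃ g : (A → Bool) → ℝ, f = fun η => g fun a => η a := by
  obtain ⟨g, hg⟩ := dependsOn_iff_exists_comp.1 hf
  exact ⟨g, hg⟩

theorem IsLocal.measurable {f : Config d → ℝ} (hf : IsLocal f) : Measurable f := by
  obtain ⟨A, hA⟩ := hf
  obtain ⟨g, rfl⟩ := exists_eq_comp_of_dependsOn hA
  exact (measurable_of_countable g).comp (by fun_prop)

theorem IsLocal.finite_range {f : Config d → ℝ} (hf : IsLocal f) : (Set.range f).Finite := by
  obtain ⟨A, hA⟩ := hf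
  obtain ⟨g, rfl⟩ := exists_eq_comp_of_dependsOn hA
  exact (Set.finite_range g).subset (by rintro _ ⟨η, rfl⟩; exact ⟨_, rfl⟩)

theorem IsLocal.exists_bound {f : Config d → ℝ} (hf : IsLocal f) : ∃ C, ∀ η, ‖f η‖ ≤ C := by
  obtain ⟨C, hC⟩ := hf.finite_range.isBounded.exists_norm_le
  exact ⟨C, fun η => hC _ ⟨η, rfl⟩⟩

theorem IsLocal.memLp {f : Config d → ℝ} (hf : IsLocal f) (p : ℝ≥0∞) (μ : Measure (Config d))
    [IsFiniteMeasure μ] : MemLp f p μ := by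
  obtain ⟨C, hC⟩ := hf.exists_bound
  exact MemLp.of_bound hf.measurable.aestronglyMeasurable C (Eventually.of_forall hC)

theorem IsLocal.integrable {f : Config d → ℝ} (hf : IsLocal f) (μ : Measure (Config d))
    [IsFiniteMeasure μ] : Integrable f μ :=
  memLp_one_iff_integrable.1 (hf.memLp 1 μ)

theorem IsLocal.const (c : ℝ) : IsLocal fun _ : Config d => c := ⟨∅, fun _ _ _ => rfl⟩

theorem IsLocal.map₂ {f g : Config d → ℝ} (hf : IsLocal f) (hg : IsLocal g) (φ : ℝ → ℝ → ℝ) :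
    IsLocal fun η => φ (f η) (g η) := by
  classical
  obtain ⟨A, hA⟩ := hf
  obtain ⟨B, hB⟩ := hg
  refine ⟨A ∪ B, fun η η' h => ?_⟩
  beta_reduce
  rw [hA fun x hx => h x (by simp [Finset.mem_coe.1 hx]),
    hB fun x hx => h x (by simp [Finset.mem_coe.1 hx])]

theorem IsLocal.add {f g : Config d → ℝ} (hf : IsLocal f) (hg : IsLocal g) :
    IsLocal fun η => f η + g η := hf.map₂ hg (· + ·)

theorem IsLocal.sub {f g : Config d → ℝ} (hf : IsLocal f) (hg : IsLocal g) :
    IsLocal fun η => f η - g η := hf.map₂ hg (· - ·)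

theorem IsLocal.mul {f g : Config d → ℝ} (hf : IsLocal f) (hg : IsLocal g) :
    IsLocal fun η => f η * g η := hf.map₂ hg (· * ·)

theorem IsLocal.const_mul {f : Config d → ℝ} (hf : IsLocal f) (c : ℝ) :
    IsLocal fun η => c * f η := (IsLocal.const c).mul hf

theorem IsLocal.neg {f : Config d → ℝ} (hf : IsLocal f) : IsLocal fun η => -f η :=
  hf.map₂ hf fun a _ => -a

theorem IsLocal.pow {f : Config d → ℝ} (hf : IsLocal f) (n : ℕ) : IsLocal fun η => f η ^ n :=
  hf.map₂ hf fun a _ => a ^ n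

theorem IsLocal.sum {ι : Type*} {s : Finset ι} {f : ι → Config d → ℝ}
    (hf : ∀ i ∈ s, IsLocal (f i)) : IsLocal fun η => ∑ i ∈ s, f i η := by
  classical
  induction s using Finset.induction_on with
  | empty => simpa using IsLocal.const 0
  | insert i s hi ih =>
    simp only [Finset.sum_insert hi]
    exact (hf i (by simp)).add (ih fun j hj => hf j (by simp [hj]))

theorem isLocal_occ (x : Site d) : IsLocal fun η : Config d => occ η x :=
  ⟨{x}, fun η η' h => by simp [occ, h x (by simp)]⟩

theorem IsLocal.comp_update {f : Config d → ℝ} (hf : IsLocal f) (x : Site d) (b : Bool) :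
    IsLocal fun η => f (Function.update η x b) := by
  obtain ⟨A, hA⟩ := hf
  refine ⟨A, fun η η' h => hA fun a ha => ?_⟩
  by_cases hax : a = x
  · subst hax; simp
  · simp [Function.update_of_ne hax, h a ha]

theorem IsLocal.comp_shift {f : Config d → ℝ} (hf : IsLocal f) (z : Site d) :
    IsLocal fun η => f (shift z η) := by
  classical
  obtain ⟨A, hA⟩ := hf
  refine ⟨A.image (z + ·), fun η η' h => hA fun a ha => h _ ?_⟩
  simpa using ha

/-! ## The product measure -/

theorem measurePreserving_shift (q : I) (z : Site d) :
    MeasurePreserving (shift z) (mu d q) (mu d q) := by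
  refine ⟨by unfold shift; fun_prop, ?_⟩
  exact Measure.map_infinitePi_infinitePi_of_inj
    (P := fun _ : Site d => ProbabilityTheory.bernoulliMeasure false true q)
    (f := fun x => z + x) (add_right_injective z)

theorem integral_comp_shift (q : I) (z : Site d) {f : Config d → ℝ} (hf : IsLocal f) :
    ∫ η, f (shift z η) ∂(mu d q) = ∫ η, f η ∂(mu d q) := by
  have h := (measurePreserving_shift q z).map_eq
  conv_rhs => rw [← h]
  rw [integral_map (measurePreserving_shift q z).measurable.aemeasurable
    hf.measurable.aestronglyMeasurable]

theorem measurable_update_prod (x : Site d) :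
    Measurable fun p : Config d × Bool => Function.update p.1 x p.2 := by
  refine measurable_pi_lambda _ fun a => ?_
  by_cases hax : a = x
  · subst hax; simpa using measurable_snd
  · simp only [Function.update_of_ne hax]; fun_prop

/-- Replacing the spin at `x` by an independent Bernoulli one preserves a product measure. This
makes `resample` a conditional expectation; it is enough to compare finite rectangles. -/
theorem map_update_mu (q : I) (x : Site d) :
    ((mu d q).prod (ProbabilityTheory.bernoulliMeasure false true q)).map
      (fun p : Config d × Bool => Function.update p.1 x p.2) = mu d q := by
  classical
  have hm := measurable_update_prod x
  refine Measure.eq_infinitePi _ fun s t ht => ?_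
  rw [Measure.map_apply hm (MeasurableSet.pi s.countable_toSet fun i _ => ht i)]
  have e : (fun p : Config d × Bool => Function.update p.1 x p.2) ⁻¹' (s : Set (Site d)).pi t =
      ((s.erase x : Finset (Site d)) : Set (Site d)).pi t ×ˢ (if x ∈ s then t x else Set.univ) := by
    ext p
    simp only [Set.mem_preimage, Set.mem_pi, Set.mem_prod, Finset.mem_coe, Finset.mem_erase]
    constructor
    · intro h
      refine ⟨fun i hi => by simpa [Function.update_of_ne hi.1] using h i hi.2, ?_⟩
      split_ifs with hx
      · simpa using h x hx
      · trivial
    · rintro ⟨h1, h2⟩ i hi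
      by_cases hix : i = x
      · subst hix; simpa [hi] using h2
      · simpa [Function.update_of_ne hix] using h1 i ⟨hix, hi⟩
  rw [e, Measure.prod_prod, mu, Measure.infinitePi_pi _ fun i _ => ht i]
  split_ifs with hx
  · rw [mul_comm, Finset.mul_prod_erase s (fun i =>
      ProbabilityTheory.bernoulliMeasure false true q (t i)) hx]
  · rw [Finset.erase_eq_of_notMem hx, measure_univ, mul_one]

/-! ## Resampling of a site -/

/-- The conditional expectation of `f` given all coordinates except the one at `x`. -/
def resample (q : I) (x : Site d) (f : Config d → ℝ) (η : Config d) : ℝ :=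
  (q : ℝ) * f (Function.update η x false) + (1 - (q : ℝ)) * f (Function.update η x true)

/-- The deviation of `f` from its conditional expectation given all coordinates except `x`. -/
def siteGrad (q : I) (x : Site d) (f : Config d → ℝ) (η : Config d) : ℝ :=
  f η - resample q x f η

theorem IsLocal.resample {f : Config d → ℝ} (hf : IsLocal f) (q : I) (x : Site d) :
    IsLocal (resample q x f) :=
  ((hf.comp_update x false).const_mul _).add ((hf.comp_update x true).const_mul _)

theorem IsLocal.siteGrad {f : Config d → ℝ} (hf : IsLocal f) (q : I) (x : Site d) :
    IsLocal (siteGrad q x f) := hf.sub (hf.resample q x)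

theorem integral_resample (q : I) (x : Site d) {f : Config d → ℝ} (hf : IsLocal f) :
    ∫ η, resample q x f η ∂(mu d q) = ∫ η, f η ∂(mu d q) := by
  have hm := measurable_update_prod x
  obtain ⟨C, hC⟩ := hf.exists_bound
  conv_rhs => rw [← map_update_mu q x]
  rw [integral_map hm.aemeasurable hf.measurable.aestronglyMeasurable, integral_prod]
  · simp only [ProbabilityTheory.integral_bernoulliMeasure, smul_eq_mul]
    rfl
  · exact memLp_one_iff_integrable.1 (MemLp.of_bound
      (hf.measurable.comp hm).aestronglyMeasurable C (Eventually.of_forall fun p => hC _))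

theorem resample_mul_left (q : I) (x : Site d) {k : Config d → ℝ}
    (hk : ∀ η b, k (Function.update η x b) = k η) (f : Config d → ℝ) (η : Config d) :
    resample q x (fun η => k η * f η) η = k η * resample q x f η := by
  simp only [resample, hk]; ring

theorem siteGrad_mul_left (q : I) (x : Site d) {k : Config d → ℝ}
    (hk : ∀ η b, k (Function.update η x b) = k η) (f : Config d → ℝ) :
    siteGrad q x (fun η => k η * f η) = fun η => k η * siteGrad q x f η := by
  funext η
  rw [siteGrad, resample_mul_left q x hk, siteGrad]; ring

theorem resample_update (q : I) (x : Site d) (f : Config d → ℝ) (η : Config d) (b : Bool) :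
    resample q x f (Function.update η x b) = resample q x f η := by
  simp [resample]

theorem resample_siteGrad (q : I) (x : Site d) (f : Config d → ℝ) (η : Config d) :
    resample q x (siteGrad q x f) η = 0 := by
  simp only [resample, siteGrad, Function.update_idem]; ring

theorem siteGrad_comm (q : I) (x y : Site d) (f : Config d → ℝ) :
    siteGrad q x (siteGrad q y f) = siteGrad q y (siteGrad q x f) := by
  rcases eq_or_ne x y with rfl | h
  · rfl
  funext η
  simp only [resample, siteGrad, Function.update_comm h]; ring

theorem siteGrad_add (q : I) (x : Site d) (f g : Config d → ℝ) (η : Config d) :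
    siteGrad q x (fun η => f η + g η) η = siteGrad q x f η + siteGrad q x g η := by
  simp only [resample, siteGrad]; ring

theorem siteGrad_const_mul (q : I) (x : Site d) (c : ℝ) (f : Config d → ℝ) (η : Config d) :
    siteGrad q x (fun η => c * f η) η = c * siteGrad q x f η := by
  simp only [resample, siteGrad]; ring

theorem siteGrad_sum {ι : Type*} (q : I) (x : Site d) (s : Finset ι) (f : ι → Config d → ℝ)
    (η : Config d) :
    siteGrad q x (fun η => ∑ i ∈ s, f i η) η = ∑ i ∈ s, siteGrad q x (f i) η := by
  simp only [resample, siteGrad, Finset.sum_sub_distrib, Finset.sum_add_distrib, Finset.mul_sum]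

theorem siteGrad_eq_zero (q : I) {x : Site d} {A : Set (Site d)} (hx : x ∉ A) {f : Config d → ℝ}
    (hf : DependsOn f A) (η : Config d) : siteGrad q x f η = 0 := by
  have h : ∀ b, f (Function.update η x b) = f η := fun b => hf fun a ha =>
    Function.update_of_ne (ne_of_mem_of_not_mem ha hx) _ _
  simp only [resample, siteGrad, h]; ring

theorem dependsOn_siteGrad (q : I) (x : Site d) {A : Set (Site d)} {f : Config d → ℝ}
    (hf : DependsOn f A) : DependsOn (siteGrad q x f) A := by
  intro η η' h
  have h1 : ∀ b, f (Function.update η x b) = f (Function.update η' x b) := fun b =>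
    hf fun a ha => by
      by_cases hax : a = x
      · subst hax; simp
      · simp [Function.update_of_ne hax, h a ha]
  simp only [resample, Tracer.siteGrad, h1, hf h]

/-- `siteGrad` is the orthogonal projection complementary to conditional expectation, so it is
self-adjoint and idempotent. -/
theorem integral_siteGrad_mul_siteGrad (q : I) (x : Site d) {f g : Config d → ℝ} (hf : IsLocal f)
    (hg : IsLocal g) :
    ∫ η, siteGrad q x f η * siteGrad q x g η ∂(mu d q) = ∫ η, siteGrad q x f η * g η ∂(mu d q) := by
  have h0 : ∫ η, resample q x g η * siteGrad q x f η ∂(mu d q) = 0 := by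
    rw [← integral_resample q x ((hg.resample q x).mul (hf.siteGrad q x))]
    simp [resample_mul_left q x (resample_update q x g), resample_siteGrad]
  have h1 : ∀ η, siteGrad q x f η * siteGrad q x g η =
      siteGrad q x f η * g η - resample q x g η * siteGrad q x f η := fun η => by
    rw [siteGrad, siteGrad]; ring
  simp_rw [h1]
  rw [integral_sub (((hf.siteGrad q x).mul hg).integrable _)
    (((hg.resample q x).mul (hf.siteGrad q x)).integrable _), h0, sub_zero]

theorem integral_one_sub_occ_mul (q : I) (x : Site d) {k : Config d → ℝ} (hk : IsLocal k)
    (hkx : ∀ η b, k (Function.update η x b) = k η) :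
    ∫ η, k η * (1 - occ η x) ∂(mu d q) = q * ∫ η, k η ∂(mu d q) := by
  rw [← integral_resample q x (hk.mul ((IsLocal.const 1).sub (isLocal_occ x))),
    ← integral_const_mul]
  congr 1
  funext η
  rw [resample_mul_left q x hkx]
  simp [resample, occ, mul_comm]

end Tracer

namespace Tracer

variable {d : ℕ}

/-! ## The generator of the environment on local functions -/

/-- A finite neighbourhood of the origin that determines the constraints. -/
def KCSM.nbhd (K : KCSM d) : Finset (Site d) := K.finite_range.choose

theorem KCSM.c_congr (K : KCSM d) (x : Site d) (η η' : Config d)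
    (h : ∀ a ∈ K.nbhd, η (x + a) = η' (x + a)) : K.c x η = K.c x η' :=
  K.finite_range.choose_spec x η η' h

/-- The constraint as a real number. -/
def KCSM.ind (K : KCSM d) (y : Site d) (η : Config d) : ℝ := if K.c y η then 1 else 0

theorem KCSM.ind_nonneg (K : KCSM d) (y : Site d) (η : Config d) : 0 ≤ K.ind y η := by
  unfold KCSM.ind; split_ifs <;> norm_num

theorem KCSM.ind_le_one (K : KCSM d) (y : Site d) (η : Config d) : K.ind y η ≤ 1 := by
  unfold KCSM.ind; split_ifs <;> norm_num

theorem KCSM.ind_update_self (K : KCSM d) (y : Site d) (η : Config d) (b : Bool) :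
    K.ind y (Function.update η y b) = K.ind y η := by
  have h : K.c y (Function.update η y b) = K.c y η := by
    by_cases hb : b = η y
    · rw [hb, Function.update_eq_self]
    · rw [Bool.eq_not_of_ne hb]
      exact K.c_flip y η
  simp [KCSM.ind, h]

theorem KCSM.ind_update_of_forall_ne (K : KCSM d) {x y : Site d} (h : ∀ a ∈ K.nbhd, y + a ≠ x)
    (η : Config d) (b : Bool) : K.ind y (Function.update η x b) = K.ind y η := by
  rw [KCSM.ind, KCSM.ind, K.c_congr y (Function.update η x b) η fun a ha =>
    Function.update_of_ne (h a ha) _ _]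

theorem KCSM.dependsOn_ind (K : KCSM d) (y : Site d) {B : Set (Site d)}
    (h : ∀ a ∈ K.nbhd, y + a ∈ B) : DependsOn (K.ind y) B := fun η η' hη => by
  rw [KCSM.ind, KCSM.ind, K.c_congr y η η' fun a ha => hη _ (h a ha)]

theorem KCSM.isLocal_ind (K : KCSM d) (y : Site d) : IsLocal (K.ind y) := by
  classical
  exact ⟨K.nbhd.image (y + ·), K.dependsOn_ind y fun a ha => by simpa using ha⟩

/-- The operator `c_y (1 - μ_y)`, minus which is the part of the generator at the site `y`. -/
def KCSM.siteOp (K : KCSM d) (q : I) (y : Site d) (f : Config d → ℝ) (η : Config d) : ℝ :=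
  K.ind y η * siteGrad q y f η

theorem IsLocal.siteOp {f : Config d → ℝ} (hf : IsLocal f) (K : KCSM d) (q : I) (y : Site d) :
    IsLocal (K.siteOp q y f) := (K.isLocal_ind y).mul (hf.siteGrad q y)

theorem KCSM.dependsOn_siteOp (K : KCSM d) (q : I) (y : Site d) {B : Set (Site d)}
    (h : ∀ a ∈ K.nbhd, y + a ∈ B) {f : Config d → ℝ} (hf : DependsOn f B) :
    DependsOn (K.siteOp q y f) B := fun η η' hη => by
  rw [KCSM.siteOp, KCSM.siteOp, K.dependsOn_ind y h hη, dependsOn_siteGrad q y hf hη]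

/-- An empty site fills at rate `1 - q` and an occupied one empties at rate `q`, so an allowed flip
contributes `μ_y f - f` in both cases. Sites outside the support of `f` contribute nothing, which
makes the sum finite. -/
theorem KCSM.envOp_eq (K : KCSM d) (q : I) {B : Finset (Site d)} {f : Config d → ℝ}
    (hf : DependsOn f (B : Set (Site d))) :
    K.envOp q f = fun η => -∑ y ∈ B, K.siteOp q y f η := by
  have h : ∀ y η, K.rate q y η * (f (flipAt y η) - f η) = -K.siteOp q y f η := by
    intro y η
    cases hy : η y
    · have e : Function.update η y false = η := by rw [← hy, Function.update_eq_self]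
      simp only [KCSM.rate, KCSM.siteOp, KCSM.ind, flipAt, siteGrad, resample, occ, hy, e,
        Bool.not_false]
      cases K.c y η <;> simp
      ring
    · have e : Function.update η y true = η := by rw [← hy, Function.update_eq_self]
      simp only [KCSM.rate, KCSM.siteOp, KCSM.ind, flipAt, siteGrad, resample, occ, hy, e,
        Bool.not_true]
      cases K.c y η <;> simp
      ring
  funext η
  simp only [KCSM.envOp, h]
  rw [tsum_eq_sum (s := B), Finset.sum_neg_distrib]
  intro y hy
  rw [KCSM.siteOp, siteGrad_eq_zero q (by simpa using hy) hf, mul_zero, neg_zero]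

theorem IsLocal.envOp {f : Config d → ℝ} (hf : IsLocal f) (K : KCSM d) (q : I) :
    IsLocal (K.envOp q f) := by
  obtain ⟨B, hB⟩ := id hf
  rw [K.envOp_eq q hB]
  exact (IsLocal.sum fun y _ => hf.siteOp K q y).neg

/-- The constraint at `y` ignores the spin at `y`, so it passes through the projection `siteGrad q
y`. Symmetry and positivity of the environment generator follow. -/
theorem KCSM.integral_siteOp_mul (K : KCSM d) (q : I) (y : Site d) {f g : Config d → ℝ}
    (hf : IsLocal f) (hg : IsLocal g) :
    ∫ η, K.siteOp q y f η * g η ∂(mu d q) =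
      ∫ η, K.ind y η * (siteGrad q y f η * siteGrad q y g η) ∂(mu d q) := by
  have h1 := siteGrad_mul_left q y (K.ind_update_self y) f
  have h2 := integral_siteGrad_mul_siteGrad q y ((K.isLocal_ind y).mul hf) hg
  simp only [h1] at h2
  simp only [KCSM.siteOp]
  rw [← h2]
  simp only [mul_assoc]

theorem KCSM.integral_siteOp_mul_comm (K : KCSM d) (q : I) (y : Site d) {f g : Config d → ℝ}
    (hf : IsLocal f) (hg : IsLocal g) :
    ∫ η, K.siteOp q y f η * g η ∂(mu d q) = ∫ η, f η * K.siteOp q y g η ∂(mu d q) := by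
  rw [K.integral_siteOp_mul q y hf hg]
  simp_rw [mul_comm (f _)]
  rw [K.integral_siteOp_mul q y hg hf]
  simp_rw [mul_comm (siteGrad q y f _)]

theorem KCSM.integral_siteOp_mul_self_nonneg (K : KCSM d) (q : I) (y : Site d) {f : Config d → ℝ}
    (hf : IsLocal f) : 0 ≤ ∫ η, K.siteOp q y f η * f η ∂(mu d q) := by
  rw [K.integral_siteOp_mul q y hf hf]
  exact integral_nonneg fun η => mul_nonneg (K.ind_nonneg y η) (mul_self_nonneg _)

theorem KCSM.integral_envOp_mul (K : KCSM d) (q : I) {B : Finset (Site d)} {f g : Config d → ℝ}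
    (hf : DependsOn f (B : Set (Site d))) (hg : IsLocal g) :
    ∫ η, K.envOp q f η * g η ∂(mu d q) = -∑ y ∈ B, ∫ η, K.siteOp q y f η * g η ∂(mu d q) := by
  have hf' : IsLocal f := ⟨B, hf⟩
  rw [K.envOp_eq q hf, ← integral_finsetSum _ fun y _ =>
    ((hf'.siteOp K q y).mul hg).integrable _, ← integral_neg]
  simp only [Finset.sum_mul, neg_mul]

theorem KCSM.integral_envOp_mul_comm (K : KCSM d) (q : I) {f g : Config d → ℝ}
    (hf : IsLocal f) (hg : IsLocal g) :
    ∫ η, K.envOp q f η * g η ∂(mu d q) = ∫ η, f η * K.envOp q g η ∂(mu d q) := by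
  classical
  obtain ⟨A, hA⟩ := id hf
  obtain ⟨B, hB⟩ := id hg
  have hA' : DependsOn f ((A ∪ B : Finset (Site d)) : Set (Site d)) := hA.mono (by simp)
  have hB' : DependsOn g ((A ∪ B : Finset (Site d)) : Set (Site d)) := hB.mono (by simp)
  simp_rw [mul_comm (f _)]
  rw [K.integral_envOp_mul q hA' hg, K.integral_envOp_mul q hB' hf]
  simp_rw [K.integral_siteOp_mul_comm q _ hf hg, mul_comm (f _)]

theorem KCSM.integral_envOp_mul_self_nonpos (K : KCSM d) (q : I) {f : Config d → ℝ}
    (hf : IsLocal f) : ∫ η, K.envOp q f η * f η ∂(mu d q) ≤ 0 := by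
  obtain ⟨A, hA⟩ := id hf
  rw [K.integral_envOp_mul q hA hf]
  exact neg_nonpos.2 (Finset.sum_nonneg fun y _ => K.integral_siteOp_mul_self_nonneg q y hf)

theorem KCSM.envOp_add (K : KCSM d) (q : I) {f g : Config d → ℝ}
    (hf : IsLocal f) (hg : IsLocal g) (η : Config d) :
    K.envOp q (fun η => f η + g η) η = K.envOp q f η + K.envOp q g η := by
  classical
  obtain ⟨A, hA⟩ := hf
  obtain ⟨B, hB⟩ := hg
  have hA' : DependsOn f ((A ∪ B : Finset (Site d)) : Set (Site d)) := hA.mono (by simp)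
  have hB' : DependsOn g ((A ∪ B : Finset (Site d)) : Set (Site d)) := hB.mono (by simp)
  have hAB : DependsOn (fun η => f η + g η) ((A ∪ B : Finset (Site d)) : Set (Site d)) :=
    fun η η' h => by beta_reduce; rw [hA' h, hB' h]
  simp only [K.envOp_eq q hA', K.envOp_eq q hB', K.envOp_eq q hAB, KCSM.siteOp, siteGrad_add,
    mul_add, Finset.sum_add_distrib]
  ring

theorem KCSM.envOp_const_mul (K : KCSM d) (q : I) (c : ℝ) (f : Config d → ℝ) (η : Config d) :
    K.envOp q (fun η => c * f η) η = c * K.envOp q f η := by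
  simp only [KCSM.envOp, ← mul_sub, ← tsum_mul_left]
  congr 1; funext y; ring

/-! ## The jumps of the tracer -/

/-- The rate of the jump by `z`. -/
def jumpRate (z : Site d) (η : Config d) : ℝ := (1 - occ η 0) * (1 - occ η z)

/-- The part of the generator that comes from jumps by `z`. -/
def jumpBy (z : Site d) (f : Config d → ℝ) (η : Config d) : ℝ :=
  jumpRate z η * (f (shift z η) - f η)

theorem jumpRate_nonneg (z : Site d) (η : Config d) : 0 ≤ jumpRate z η :=
  mul_nonneg (occ_mem η 0).1 (occ_mem η z).1

theorem jumpRate_le_one (z : Site d) (η : Config d) : jumpRate z η ≤ 1 :=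
  mul_le_one₀ (occ_mem η 0).2 (occ_mem η z).1 (occ_mem η z).2

theorem isLocal_jumpRate (z : Site d) : IsLocal (jumpRate (d := d) z) :=
  ((IsLocal.const 1).sub (isLocal_occ 0)).mul ((IsLocal.const 1).sub (isLocal_occ z))

theorem IsLocal.jumpBy {f : Config d → ℝ} (hf : IsLocal f) (z : Site d) : IsLocal (jumpBy z f) :=
  (isLocal_jumpRate z).mul ((hf.comp_shift z).sub hf)

theorem jumpOp_eq (f : Config d → ℝ) (η : Config d) :
    jumpOp f η = ∑ i, (jumpBy (unitVec i) f η + jumpBy (-unitVec i) f η) := by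
  simp [jumpOp, jumpBy, jumpRate, Finset.sum_pair (show (1 : ℤ) ≠ -1 by norm_num)]

theorem IsLocal.jumpOp {f : Config d → ℝ} (hf : IsLocal f) : IsLocal (jumpOp f) := by
  have h : Tracer.jumpOp f = fun η => ∑ i, (Tracer.jumpBy (unitVec i) f η +
      Tracer.jumpBy (-unitVec i) f η) :=
    funext (jumpOp_eq f)
  rw [h]
  exact IsLocal.sum fun i _ => (hf.jumpBy _).add (hf.jumpBy _)

theorem current_eq (u : Fin d → ℝ) (η : Config d) :
    current u η = ∑ i, u i * (jumpRate (unitVec i) η - jumpRate (-unitVec i) η) := by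
  simp only [current, jumpRate, Finset.mul_sum, Finset.sum_pair (show (1 : ℤ) ≠ -1 by norm_num)]
  refine Finset.sum_congr rfl fun i _ => ?_
  simp; ring

theorem isLocal_current (u : Fin d → ℝ) : IsLocal (current u) := by
  rw [funext (current_eq u)]
  exact IsLocal.sum fun i _ => ((isLocal_jumpRate _).sub (isLocal_jumpRate _)).const_mul _

theorem shift_shift_neg (z : Site d) (η : Config d) : shift z (shift (-z) η) = η := by
  funext x; simp [shift]

theorem jumpRate_shift (z : Site d) (η : Config d) :
    jumpRate (-z) (shift z η) = jumpRate z η := by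
  simp [jumpRate, shift, occ, mul_comm]

/-- Detailed balance for the jumps of the tracer. -/
theorem integral_jumpRate_neg_mul (q : I) (z : Site d) {f g : Config d → ℝ} (hf : IsLocal f)
    (hg : IsLocal g) :
    ∫ η, jumpRate (-z) η * (f (shift (-z) η) * g η) ∂(mu d q) =
      ∫ η, jumpRate z η * (f η * g (shift z η)) ∂(mu d q) := by
  rw [← integral_comp_shift q z
    ((isLocal_jumpRate (-z)).mul ((hf.comp_shift (-z)).mul hg))]
  congr 1
  funext η
  have := shift_shift_neg (-z) η
  rw [neg_neg] at this
  rw [this, jumpRate_shift]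

/-- The Dirichlet form of the jumps along one bond. -/
def bondForm (q : I) (z : Site d) (f g : Config d → ℝ) : ℝ :=
  ∫ η, jumpRate z η * ((f (shift z η) - f η) * (g (shift z η) - g η)) ∂(mu d q)

/-- Pairing a jump with its reversal turns the two oriented terms into one Dirichlet form per bond,
with no factor `1/2`. -/
theorem integral_jumpBy_add_jumpBy_neg (q : I) (z : Site d) {f g : Config d → ℝ} (hf : IsLocal f)
    (hg : IsLocal g) :
    ∫ η, (jumpBy z f η + jumpBy (-z) f η) * g η ∂(mu d q) = -bondForm q z f g := by
  have h1 := integral_jumpRate_neg_mul q z hf hg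
  have h2 := integral_jumpRate_neg_mul q z (IsLocal.const 1) (hf.mul hg)
  have hz := isLocal_jumpRate (d := d) z
  have hz' := isLocal_jumpRate (d := d) (-z)
  have i1 := (hz'.mul ((hf.comp_shift (-z)).mul hg)).integrable (mu d q)
  have i2 := (hz'.mul ((IsLocal.const 1).mul (hf.mul hg))).integrable (mu d q)
  have i3 := (hz.mul (hf.mul (hg.comp_shift z))).integrable (mu d q)
  have i4 := (hz.mul ((IsLocal.const 1).mul ((hf.mul hg).comp_shift z))).integrable (mu d q)
  have i5 := ((hf.jumpBy z).mul hg).integrable (mu d q)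
  have e1 : ∀ η, (jumpBy z f η + jumpBy (-z) f η) * g η = jumpBy z f η * g η +
      (jumpRate (-z) η * (f (shift (-z) η) * g η) - jumpRate (-z) η * (1 * (f η * g η))) :=
    fun η => by simp only [jumpBy]; ring
  have e2 : ∀ η, jumpRate z η * ((f (shift z η) - f η) * (g (shift z η) - g η)) =
      (jumpRate z η * (1 * (f (shift z η) * g (shift z η))) -
        jumpRate z η * (f η * g (shift z η))) - jumpBy z f η * g η :=
    fun η => by simp only [jumpBy]; ring
  have i12 : Integrable (fun η => jumpRate (-z) η * (f (shift (-z) η) * g η) -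
      jumpRate (-z) η * (1 * (f η * g η))) (mu d q) := i1.sub i2
  have i43 : Integrable (fun η => jumpRate z η * (1 * (f (shift z η) * g (shift z η))) -
      jumpRate z η * (f η * g (shift z η))) (mu d q) := i4.sub i3
  simp only [bondForm, e1, e2]
  rw [integral_add i5 i12, integral_sub i1 i2, integral_sub i43 i5,
    integral_sub i4 i3, h1, h2]
  ring

theorem integral_jumpOp_mul (q : I) {f g : Config d → ℝ} (hf : IsLocal f) (hg : IsLocal g) :
    ∫ η, jumpOp f η * g η ∂(mu d q) = -∑ i, bondForm q (unitVec i) f g := by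
  simp only [jumpOp_eq, Finset.sum_mul]
  rw [integral_finsetSum _ fun i _ =>
    (((hf.jumpBy _).add (hf.jumpBy _)).mul hg).integrable _]
  simp only [integral_jumpBy_add_jumpBy_neg q _ hf hg, Finset.sum_neg_distrib]

theorem bondForm_comm (q : I) (z : Site d) (f g : Config d → ℝ) :
    bondForm q z f g = bondForm q z g f := by
  simp only [bondForm, mul_comm (f _ - f _)]

theorem bondForm_self_nonneg (q : I) (z : Site d) (f : Config d → ℝ) : 0 ≤ bondForm q z f f :=
  integral_nonneg fun η => mul_nonneg (jumpRate_nonneg z η) (mul_self_nonneg _)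

/-- Use `(a - b)² ≤ 2a² + 2b²`, rate at most one, and shift invariance. The free constant `m` is
later the mean of `f`, which produces the variance. -/
theorem bondForm_self_le (q : I) (z : Site d) {f : Config d → ℝ} (hf : IsLocal f) (m : ℝ) :
    bondForm q z f f ≤ 4 * ∫ η, (f η - m) ^ 2 ∂(mu d q) := by
  have hm : IsLocal fun η => (f η - m) ^ 2 := (hf.sub (IsLocal.const m)).pow 2
  have h1 : bondForm q z f f ≤
      ∫ η, (2 * (f (shift z η) - m) ^ 2 + 2 * (f η - m) ^ 2) ∂(mu d q) := by
    refine integral_mono (((isLocal_jumpRate z).mul (((hf.comp_shift z).sub hf).mul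
      ((hf.comp_shift z).sub hf))).integrable _)
      ((((hm.comp_shift z).const_mul 2).add (hm.const_mul 2)).integrable _) fun η => ?_
    beta_reduce
    nlinarith [jumpRate_nonneg z η, jumpRate_le_one z η, sq_nonneg (f (shift z η) - f η),
      sq_nonneg (f (shift z η) - m + (f η - m))]
  refine h1.trans_eq ?_
  rw [integral_add (((hm.comp_shift z).const_mul 2).integrable _)
    ((hm.const_mul 2).integrable _), integral_const_mul, integral_const_mul,
    integral_comp_shift q z hm]
  ring

theorem integral_jumpRate_unitVec (q : I) (i : Fin d) :
    ∫ η, jumpRate (unitVec i) η ∂(mu d q) = (q : ℝ) ^ 2 := by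
  have hne : (0 : Site d) ≠ unitVec i := fun h => by
    have := congrFun h i
    simp [unitVec] at this
  have h0 := integral_one_sub_occ_mul q (0 : Site d) (IsLocal.const 1) (fun _ _ => rfl)
  have h1 := integral_one_sub_occ_mul q (unitVec i) (k := fun η => 1 - occ η 0)
    ((IsLocal.const 1).sub (isLocal_occ 0)) (fun η b => by
      simp [occ, Function.update_of_ne hne])
  simp only [one_mul] at h0
  simp only [jumpRate]
  rw [h1, h0]
  simp; ring

/-! ### The current tested against local functions -/

theorem integral_jumpRate_mul_sub (q : I) (z : Site d) {f : Config d → ℝ} (hf : IsLocal f) :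
    ∫ η, (jumpRate z η - jumpRate (-z) η) * f η ∂(mu d q) =
      -∫ η, jumpRate z η * (f (shift z η) - f η) ∂(mu d q) := by
  have h2 := integral_jumpRate_neg_mul q z (IsLocal.const 1) hf
  have i1 := ((isLocal_jumpRate z).mul hf).integrable (mu d q)
  have i2 := ((isLocal_jumpRate (-z)).mul hf).integrable (mu d q)
  have i3 := ((isLocal_jumpRate z).mul (hf.comp_shift z)).integrable (mu d q)
  simp only [one_mul] at h2
  simp only [sub_mul, mul_sub]
  rw [integral_sub i1 i2, integral_sub i3 i1, h2]; ring

/-- The `H₋₁` bound on the current. -/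
theorem sq_integral_current_mul_le (q : I) (u : Fin d → ℝ) {f : Config d → ℝ} (hf : IsLocal f) :
    (∫ η, current u η * f η ∂(mu d q)) ^ 2 ≤
      ((q : ℝ) ^ 2 * ∑ i, u i ^ 2) * ∑ i, bondForm q (unitVec i) f f := by
  have h1 : ∫ η, current u η * f η ∂(mu d q) =
      ∑ i, u i * -∫ η, jumpRate (unitVec i) η * (f (shift (unitVec i) η) - f η) ∂(mu d q) := by
    simp only [current_eq, Finset.sum_mul, mul_assoc]
    rw [integral_finsetSum _ fun i _ => ((((isLocal_jumpRate _).sub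
      (isLocal_jumpRate _)).mul hf).const_mul _).integrable _]
    simp only [integral_const_mul, integral_jumpRate_mul_sub q _ hf]
  have h2 : ∀ i : Fin d,
      (∫ η, jumpRate (unitVec i) η * (f (shift (unitVec i) η) - f η) ∂(mu d q)) ^ 2 ≤
      (q : ℝ) ^ 2 * bondForm q (unitVec i) f f := by
    intro i
    set r := jumpRate (d := d) (unitVec i) with hr
    set g : Config d → ℝ := fun η => f (shift (unitVec i) η) - f η with hg
    have hrl : IsLocal r := isLocal_jumpRate _
    have hgl : IsLocal g := (hf.comp_shift _).sub hf
    -- Cauchy–Schwarz for the weight `r`, by the discriminant of `t ↦ μ(r (t g + 1)²)`; the constant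
    -- term is `μ(r) = q²`.
    have hquad : ∀ t : ℝ, 0 ≤ bondForm q (unitVec i) f f * (t * t) +
        (2 * ∫ η, r η * g η ∂(mu d q)) * t + (q : ℝ) ^ 2 := by
      intro t
      have h3 : 0 ≤ ∫ η, r η * (t * g η + 1) ^ 2 ∂(mu d q) :=
        integral_nonneg fun η => mul_nonneg (jumpRate_nonneg _ η) (sq_nonneg _)
      have e : ∀ η, r η * (t * g η + 1) ^ 2 =
          (t * t) * (r η * (g η * g η)) + (2 * t) * (r η * g η) + r η := fun η => by ring
      simp only [e] at h3
      rw [integral_add ((((hrl.mul (hgl.mul hgl)).const_mul _).add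
        ((hrl.mul hgl).const_mul _)).integrable _) (hrl.integrable _),
        integral_add (((hrl.mul (hgl.mul hgl)).const_mul _).integrable _)
        (((hrl.mul hgl).const_mul _).integrable _), integral_const_mul, integral_const_mul,
        hr, integral_jumpRate_unitVec] at h3
      rw [bondForm]
      linarith
    have hdisc := discrim_le_zero hquad
    rw [discrim] at hdisc
    nlinarith
  rw [h1]
  calc _ ≤ (∑ i, u i ^ 2) * ∑ i, (-∫ η, jumpRate (unitVec i) η *
        (f (shift (unitVec i) η) - f η) ∂(mu d q)) ^ 2 := Finset.sum_mul_sq_le_sq_mul_sq _ _ _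
    _ ≤ (∑ i, u i ^ 2) * ∑ i, (q : ℝ) ^ 2 * bondForm q (unitVec i) f f := by
        gcongr with i
        rw [neg_sq]; exact h2 i
    _ = _ := by rw [← Finset.mul_sum]; ring

end Tracer

namespace Tracer

variable {d : ℕ}

/-! ## Local functions in `L²(μ)` -/

open Classical in
/-- The class of `f` in `L²(μ)` (zero if `f` is not square integrable). -/
def toL2 (q : I) (f : Config d → ℝ) : L2 d q :=
  if h : MemLp f 2 (mu d q) then h.toLp f else 0

theorem coeFn_toL2 (q : I) {f : Config d → ℝ} (hf : IsLocal f) : toL2 q f =ᵐ[mu d q] f := by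
  rw [toL2, dif_pos (hf.memLp 2 _)]
  exact MemLp.coeFn_toLp _

theorem eq_toL2 (q : I) {f : Config d → ℝ} (hf : IsLocal f) {p : L2 d q} (h : p =ᵐ[mu d q] f) :
    p = toL2 q f :=
  Lp.ext (h.trans (coeFn_toL2 q hf).symm)

theorem toL2_add (q : I) {f g : Config d → ℝ} (hf : IsLocal f) (hg : IsLocal g) :
    toL2 q (fun η => f η + g η) = toL2 q f + toL2 q g := by
  refine (eq_toL2 q (hf.add hg) ?_).symm
  filter_upwards [Lp.coeFn_add (toL2 q f) (toL2 q g), coeFn_toL2 q hf, coeFn_toL2 q hg]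
    with η h1 h2 h3
  rw [h1, Pi.add_apply, h2, h3]

theorem toL2_const_mul (q : I) (c : ℝ) {f : Config d → ℝ} (hf : IsLocal f) :
    toL2 q (fun η => c * f η) = c • toL2 q f := by
  refine (eq_toL2 q (hf.const_mul c) ?_).symm
  filter_upwards [Lp.coeFn_smul c (toL2 q f), coeFn_toL2 q hf] with η h1 h2
  rw [h1, Pi.smul_apply, h2, smul_eq_mul]

theorem toL2_sub (q : I) {f g : Config d → ℝ} (hf : IsLocal f) (hg : IsLocal g) :
    toL2 q (fun η => f η - g η) = toL2 q f - toL2 q g := by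
  have h := toL2_add q hf (hg.const_mul (-1))
  rw [toL2_const_mul q _ hg] at h
  simpa [sub_eq_add_neg] using h

theorem toL2_zero (q : I) : toL2 (d := d) q (fun _ => 0) = 0 := by
  have h := toL2_const_mul q 0 (IsLocal.const (d := d) 0)
  simpa using h

theorem toL2_sum {ι : Type*} (q : I) (s : Finset ι) {f : ι → Config d → ℝ}
    (hf : ∀ i, IsLocal (f i)) :
    toL2 q (fun η => ∑ i ∈ s, f i η) = ∑ i ∈ s, toL2 q (f i) := by
  classical
  induction s using Finset.induction_on with
  | empty => simpa using toL2_zero q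
  | insert i s hi ih =>
    simp only [Finset.sum_insert hi]
    rw [toL2_add q (hf i) (IsLocal.sum fun j _ => hf j), ih]

theorem integral_mul_eq_inner (q : I) (f g : L2 d q) :
    ∫ η, f η * g η ∂(mu d q) = inner ℝ f g := by
  rw [L2.inner_def]
  simp [mul_comm]

theorem inner_toL2_right (q : I) (h : L2 d q) {f : Config d → ℝ} (hf : IsLocal f) :
    inner ℝ h (toL2 q f) = ∫ η, f η * h η ∂(mu d q) := by
  rw [← integral_mul_eq_inner]
  refine integral_congr_ae ?_
  filter_upwards [coeFn_toL2 q hf] with η h1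
  rw [h1, mul_comm]

theorem inner_toL2 (q : I) {f g : Config d → ℝ} (hf : IsLocal f) (hg : IsLocal g) :
    inner ℝ (toL2 q f) (toL2 q g) = ∫ η, f η * g η ∂(mu d q) := by
  rw [inner_toL2_right q _ hg]
  refine integral_congr_ae ?_
  filter_upwards [coeFn_toL2 q hf] with η h1
  rw [h1, mul_comm]

theorem norm_toL2_sq (q : I) {f : Config d → ℝ} (hf : IsLocal f) :
    ‖toL2 q f‖ ^ 2 = ∫ η, f η ^ 2 ∂(mu d q) := by
  rw [← real_inner_self_eq_norm_sq, inner_toL2 q hf hf]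
  simp only [sq]

theorem norm_toL2_le_of_abs_le (q : I) {f g : Config d → ℝ} (hf : IsLocal f) (hg : IsLocal g)
    (h : ∀ η, |f η| ≤ |g η|) : ‖toL2 q f‖ ≤ ‖toL2 q g‖ := by
  rw [← sq_le_sq₀ (norm_nonneg _) (norm_nonneg _), norm_toL2_sq q hf, norm_toL2_sq q hg]
  exact integral_mono ((hf.pow 2).integrable _) ((hg.pow 2).integrable _) fun η =>
    sq_le_sq.2 (h η)

theorem norm_toL2_comp_shift (q : I) (z : Site d) {f : Config d → ℝ} (hf : IsLocal f) :
    ‖toL2 q (fun η => f (shift z η))‖ = ‖toL2 q f‖ := by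
  rw [← sq_eq_sq₀ (norm_nonneg _) (norm_nonneg _), norm_toL2_sq q (hf.comp_shift z),
    norm_toL2_sq q hf]
  exact integral_comp_shift q z (hf.pow 2)

/-- Density of local functions: indicators of cylinders are local, and a π-λ argument makes every
set integral of `h` vanish. -/
theorem eq_zero_of_forall_inner_toL2 (q : I) (h : L2 d q)
    (hh : ∀ f : Config d → ℝ, IsLocal f → inner ℝ h (toL2 q f) = 0) : h = 0 := by
  have hint : Integrable h (mu d q) := (Lp.memLp h).integrable (by norm_num)
  have hall : ∀ s : Set (Config d), MeasurableSet s → ∫ η in s, h η ∂(mu d q) = 0 := by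
    have huniv : ∫ η, h η ∂(mu d q) = 0 := by
      have h1 := hh _ (IsLocal.const 1)
      rw [inner_toL2_right q _ (IsLocal.const 1)] at h1
      simpa using h1
    intro s hs
    induction s, hs using MeasurableSpace.induction_on_inter
      (generateFrom_measurableCylinders (α := fun _ : Site d => Bool)).symm
      isPiSystem_measurableCylinders with
    | empty => simp
    | basic s hs =>
      obtain ⟨A, S, hS, rfl⟩ := (mem_measurableCylinders s).1 hs
      have hloc : IsLocal ((cylinder A S).indicator fun _ : Config d => (1 : ℝ)) :=
        ⟨A, fun η η' h => Set.indicator_const_eq_indicator_const (by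
          have e : A.restrict η = A.restrict η' := funext fun a => h a a.2
          simp only [mem_cylinder, e])⟩
      have h1 := hh _ hloc
      rw [inner_toL2_right q _ hloc] at h1
      rw [← integral_indicator (hS.cylinder A), ← h1]
      congr 1
      funext η
      by_cases hη : η ∈ cylinder A S <;> simp [hη]
    | compl s hs ih =>
      have := integral_add_compl hs hint
      rw [ih, huniv, zero_add] at this
      exact this
    | iUnion f hd hm ih =>
      rw [integral_iUnion hm hd hint.integrableOn]
      simp [ih]
  refine Lp.ext ?_
  refine (hint.ae_eq_zero_of_forall_setIntegral_eq_zero fun s hs _ => hall s hs).trans ?_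
  exact (Lp.coeFn_zero ℝ 2 (mu d q)).symm

/-! ## Operators on local functions and their closures -/

/-- A linear operator on the space of local functions. -/
structure IsLocalOp (T : (Config d → ℝ) → Config d → ℝ) : Prop where
  isLocal : ∀ f, IsLocal f → IsLocal (T f)
  map_add : ∀ f g, IsLocal f → IsLocal g → ∀ η, T (fun η => f η + g η) η = T f η + T g η
  map_const_mul : ∀ c f, IsLocal f → ∀ η, T (fun η => c * f η) η = c * T f η

/-- The graph of an operator on local functions, as a subspace of `L²(μ) × L²(μ)`. -/
def localGraph (q : I) {T : (Config d → ℝ) → Config d → ℝ} (hT : IsLocalOp T) :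
    Submodule ℝ (L2 d q × L2 d q) where
  carrier := {p | ∃ f : Config d → ℝ, IsLocal f ∧ p = (toL2 q f, toL2 q (T f))}
  zero_mem' := by
    refine ⟨fun _ => 0, IsLocal.const 0, ?_⟩
    have h : T (fun _ => 0) = fun _ => 0 := by
      funext η
      have := hT.map_const_mul 0 (fun _ => 0) (IsLocal.const 0) η
      simpa using this
    rw [h, toL2_zero]; rfl
  add_mem' := by
    rintro _ _ ⟨f, hf, rfl⟩ ⟨g, hg, rfl⟩
    refine ⟨fun η => f η + g η, hf.add hg, ?_⟩
    rw [funext (hT.map_add f g hf hg), toL2_add q hf hg,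
      toL2_add q (hT.isLocal f hf) (hT.isLocal g hg)]; rfl
  smul_mem' := by
    rintro c _ ⟨f, hf, rfl⟩
    refine ⟨fun η => c * f η, hf.const_mul c, ?_⟩
    rw [funext (hT.map_const_mul c f hf), toL2_const_mul q c hf,
      toL2_const_mul q c (hT.isLocal f hf)]; rfl

theorem closedGraph_eq (q : I) {T : (Config d → ℝ) → Config d → ℝ} (hT : IsLocalOp T) :
    closedGraph q T = ((localGraph q hT).topologicalClosure : Set (L2 d q × L2 d q)) := by
  rw [Submodule.topologicalClosure_coe, closedGraph]
  congr 1
  ext p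
  constructor
  · rintro ⟨f, hf, h1, h2⟩
    exact ⟨f, hf, Prod.ext (eq_toL2 q hf h1) (eq_toL2 q (hT.isLocal f hf) h2)⟩
  · rintro ⟨f, hf, rfl⟩
    exact ⟨f, hf, coeFn_toL2 q hf, coeFn_toL2 q (hT.isLocal f hf)⟩

theorem closedGraph_induction (q : I) {T : (Config d → ℝ) → Config d → ℝ} (hT : IsLocalOp T)
    {P : L2 d q × L2 d q → Prop} (hP : IsClosed {p | P p})
    (h : ∀ f, IsLocal f → P (toL2 q f, toL2 q (T f))) : ∀ p ∈ closedGraph q T, P p := by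
  rw [closedGraph_eq q hT, Submodule.topologicalClosure_coe]
  refine closure_minimal ?_ hP
  rintro _ ⟨f, hf, rfl⟩
  exact h f hf

theorem mem_closedGraph (q : I) {T : (Config d → ℝ) → Config d → ℝ} (hT : IsLocalOp T)
    {f : Config d → ℝ} (hf : IsLocal f) : (toL2 q f, toL2 q (T f)) ∈ closedGraph q T :=
  subset_closure ⟨f, hf, coeFn_toL2 q hf, coeFn_toL2 q (hT.isLocal f hf)⟩

theorem dense_toL2 (q : I) : Dense {p : L2 d q | ∃ f, IsLocal f ∧ p = toL2 q f} := by
  have hT : IsLocalOp fun f : Config d → ℝ => f :=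
    ⟨fun _ h => h, fun _ _ _ _ _ => rfl, fun _ _ _ _ => rfl⟩
  have h : ((localGraph q hT).map (LinearMap.fst ℝ (L2 d q) (L2 d q))).topologicalClosure = ⊤ := by
    rw [Submodule.topologicalClosure_eq_top_iff, Submodule.eq_bot_iff]
    intro h hh
    refine eq_zero_of_forall_inner_toL2 q h fun f hf => ?_
    rw [real_inner_comm]
    exact (Submodule.mem_orthogonal _ _).1 hh _ ⟨(toL2 q f, toL2 q f), ⟨f, hf, rfl⟩, rfl⟩
  refine Dense.mono ?_ (Submodule.dense_iff_topologicalClosure_eq_top.2 h)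
  rintro _ ⟨_, ⟨f, hf, rfl⟩, rfl⟩
  exact ⟨f, hf, rfl⟩

theorem dense_domain_closedGraph (q : I) {T : (Config d → ℝ) → Config d → ℝ} (hT : IsLocalOp T) :
    Dense {f | ∃ g, (f, g) ∈ closedGraph q T} :=
  (dense_toL2 q).mono (by rintro _ ⟨f, hf, rfl⟩; exact ⟨_, mem_closedGraph q hT hf⟩)

theorem closedGraph_symm (q : I) {T : (Config d → ℝ) → Config d → ℝ} (hT : IsLocalOp T)
    (hs : ∀ f g, IsLocal f → IsLocal g →
      ∫ η, T f η * g η ∂(mu d q) = ∫ η, f η * T g η ∂(mu d q)) :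
    ∀ p ∈ closedGraph q T, ∀ p' ∈ closedGraph q T, inner ℝ p.2 p'.1 = inner ℝ p.1 p'.2 := by
  intro p hp
  refine closedGraph_induction q hT (isClosed_eq (by fun_prop) (by fun_prop)) fun g hg => ?_
  revert p
  refine closedGraph_induction q hT (isClosed_eq (by fun_prop) (by fun_prop)) fun f hf => ?_
  rw [inner_toL2 q (hT.isLocal f hf) hg, inner_toL2 q hf (hT.isLocal g hg)]
  exact hs f g hf hg

theorem closedGraph_dissipative (q : I) {T : (Config d → ℝ) → Config d → ℝ} (hT : IsLocalOp T)
    (hs : ∀ f, IsLocal f → ∫ η, T f η * f η ∂(mu d q) ≤ 0) :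
    ∀ p ∈ closedGraph q T, inner ℝ p.1 p.2 ≤ 0 := by
  refine closedGraph_induction q hT (isClosed_le (by fun_prop) (by fun_prop)) fun f hf => ?_
  rw [inner_toL2 q hf (hT.isLocal f hf)]
  simpa only [mul_comm] using hs f hf

/-- Dissipativity makes `l - T` bounded below on the closed graph, so its range is closed; the
orthogonality hypothesis makes it dense. -/
theorem closedGraph_surjective (q : I) {T : (Config d → ℝ) → Config d → ℝ} (hT : IsLocalOp T)
    (hs : ∀ f, IsLocal f → ∫ η, T f η * f η ∂(mu d q) ≤ 0) {l : ℝ} (hl : 0 < l)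
    (hr : ∀ h : L2 d q, (∀ f, IsLocal f → inner ℝ h (l • toL2 q f - toL2 q (T f)) = 0) → h = 0)
    (h : L2 d q) : ∃ p ∈ closedGraph q T, l • p.1 - p.2 = h := by
  have hd := closedGraph_dissipative q hT hs
  rw [closedGraph_eq q hT] at hd ⊢
  set G := (localGraph q hT).topologicalClosure with hG
  let Φ : L2 d q × L2 d q →L[ℝ] L2 d q :=
    l • ContinuousLinearMap.fst ℝ _ _ - ContinuousLinearMap.snd ℝ _ _
  have hΦ : ∀ p, Φ p = l • p.1 - p.2 := fun p => rfl
  have hcl : IsClosed (G : Set (L2 d q × L2 d q)) := Submodule.isClosed_topologicalClosure _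
  have : CompleteSpace G := hcl.completeSpace_coe
  -- With `N = ‖l p.1 - p.2‖`, one has `‖p.1‖ ≤ N / l` and `‖p.2‖ ≤ 2N`.
  have hanti : AntilipschitzWith (l⁻¹ + 2).toNNReal (Φ.comp G.subtypeL) := by
    refine ContinuousLinearMap.antilipschitz_of_bound _ fun p => ?_
    rw [Real.coe_toNNReal _ (by positivity)]
    have h1 := norm_le_norm_smul_sub (hd p p.2) l
    change ‖(p : L2 d q × L2 d q)‖ ≤ (l⁻¹ + 2) * ‖Φ p‖
    rw [hΦ]
    set N := ‖l • (p : L2 d q × L2 d q).1 - (p : L2 d q × L2 d q).2‖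
    have hN : 0 ≤ N := norm_nonneg _
    have h2 : ‖(p : L2 d q × L2 d q).1‖ ≤ l⁻¹ * N := by
      rwa [inv_mul_eq_div, le_div_iff₀' hl]
    have h3 : ‖(p : L2 d q × L2 d q).2‖ ≤ N + N := by
      have e : (p : L2 d q × L2 d q).2 = l • (p : L2 d q × L2 d q).1 -
        (l • (p : L2 d q × L2 d q).1 - (p : L2 d q × L2 d q).2) := by abel
      rw [e]
      refine (norm_sub_le _ _).trans ?_
      rw [norm_smul, Real.norm_of_nonneg hl.le]
      gcongr
    have h4 : 0 ≤ l⁻¹ * N := by positivity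
    rw [Prod.norm_def]
    exact max_le (by linarith) (by linarith)
  have hrange : IsClosed (Set.range (Φ.comp G.subtypeL)) :=
    hanti.isClosed_range (Φ.comp G.subtypeL).uniformContinuous
  have htop : (LinearMap.range (Φ.comp G.subtypeL).toLinearMap).topologicalClosure = ⊤ := by
    rw [Submodule.topologicalClosure_eq_top_iff, Submodule.eq_bot_iff]
    intro h hh
    refine hr h fun f hf => ?_
    rw [real_inner_comm]
    refine (Submodule.mem_orthogonal _ _).1 hh _ ⟨⟨(toL2 q f, toL2 q (T f)), ?_⟩, rfl⟩
    have := mem_closedGraph q hT hf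
    rwa [closedGraph_eq q hT] at this
  have hmem : h ∈ (LinearMap.range (Φ.comp G.subtypeL).toLinearMap).topologicalClosure := by
    rw [htop]; trivial
  rw [← SetLike.mem_coe, Submodule.topologicalClosure_coe] at hmem
  have hmem' : h ∈ Set.range (Φ.comp G.subtypeL) := by
    rw [← hrange.closure_eq]; exact hmem
  obtain ⟨p, hp⟩ := hmem'
  exact ⟨p, p.2, hp⟩

/-! ## The generators -/

theorem KCSM.isLocalOp_envOp (K : KCSM d) (q : I) : IsLocalOp (K.envOp q) where
  isLocal _ hf := hf.envOp K q
  map_add _ _ hf hg η := K.envOp_add q hf hg η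
  map_const_mul c f _ η := K.envOp_const_mul q c f η

theorem isLocalOp_jumpOp : IsLocalOp (jumpOp (d := d)) where
  isLocal _ hf := hf.jumpOp
  map_add f g _ _ η := by
    simp only [jumpOp_eq, jumpBy, ← Finset.sum_add_distrib]
    exact Finset.sum_congr rfl fun i _ => by ring
  map_const_mul c f _ η := by
    simp only [jumpOp_eq, jumpBy, Finset.mul_sum]
    exact Finset.sum_congr rfl fun i _ => by ring

theorem KCSM.isLocalOp_tracerOp (K : KCSM d) (q : I) : IsLocalOp (K.tracerOp q) where
  isLocal _ hf := (hf.envOp K q).add hf.jumpOp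
  map_add f g hf hg η := by
    simp only [KCSM.tracerOp, (K.isLocalOp_envOp q).map_add f g hf hg,
      isLocalOp_jumpOp.map_add f g hf hg]
    ring
  map_const_mul c f hf η := by
    simp only [KCSM.tracerOp, (K.isLocalOp_envOp q).map_const_mul c f hf,
      isLocalOp_jumpOp.map_const_mul c f hf]
    ring

theorem KCSM.integral_tracerOp_mul (K : KCSM d) (q : I) {f g : Config d → ℝ} (hf : IsLocal f)
    (hg : IsLocal g) : ∫ η, K.tracerOp q f η * g η ∂(mu d q) =
      ∫ η, K.envOp q f η * g η ∂(mu d q) - ∑ i, bondForm q (unitVec i) f g := by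
  simp only [KCSM.tracerOp, add_mul]
  rw [integral_add (((hf.envOp K q).mul hg).integrable _) ((hf.jumpOp.mul hg).integrable _),
    integral_jumpOp_mul q hf hg, sub_eq_add_neg]

theorem KCSM.integral_tracerOp_mul_comm (K : KCSM d) (q : I) {f g : Config d → ℝ}
    (hf : IsLocal f) (hg : IsLocal g) :
    ∫ η, K.tracerOp q f η * g η ∂(mu d q) = ∫ η, f η * K.tracerOp q g η ∂(mu d q) := by
  simp_rw [mul_comm (f _)]
  rw [K.integral_tracerOp_mul q hf hg, K.integral_tracerOp_mul q hg hf,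
    K.integral_envOp_mul_comm q hf hg]
  simp_rw [mul_comm (f _), bondForm_comm q _ f g]

theorem KCSM.integral_tracerOp_mul_self_nonpos (K : KCSM d) (q : I) {f : Config d → ℝ}
    (hf : IsLocal f) : ∫ η, K.tracerOp q f η * f η ∂(mu d q) ≤ 0 := by
  rw [K.integral_tracerOp_mul q hf hf]
  have h1 := K.integral_envOp_mul_self_nonpos q hf
  have h2 : 0 ≤ ∑ i, bondForm q (unitVec i) f f :=
    Finset.sum_nonneg fun i _ => bondForm_self_nonneg q _ f
  linarith

theorem norm_toL2_jumpBy_le (q : I) (z : Site d) {f : Config d → ℝ} (hf : IsLocal f) :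
    ‖toL2 q (jumpBy z f)‖ ≤ 2 * ‖toL2 q f‖ := by
  have h1 : ‖toL2 q (jumpBy z f)‖ ≤ ‖toL2 q (fun η => f (shift z η) - f η)‖ := by
    refine norm_toL2_le_of_abs_le q (hf.jumpBy z) ((hf.comp_shift z).sub hf) fun η => ?_
    rw [jumpBy, abs_mul, abs_of_nonneg (jumpRate_nonneg z η)]
    exact mul_le_of_le_one_left (abs_nonneg _) (jumpRate_le_one z η)
  rw [toL2_sub q (hf.comp_shift z) hf] at h1
  refine h1.trans ((norm_sub_le _ _).trans ?_)
  rw [norm_toL2_comp_shift q z hf]; linarith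

/-- There are `2d` jump directions, each an operator of norm at most `2`. -/
theorem norm_toL2_jumpOp_le (q : I) {f : Config d → ℝ} (hf : IsLocal f) :
    ‖toL2 q (jumpOp f)‖ ≤ 4 * d * ‖toL2 q f‖ := by
  rw [funext (jumpOp_eq f), toL2_sum q _ fun i => (hf.jumpBy _).add (hf.jumpBy _)]
  refine (norm_sum_le _ _).trans ?_
  calc _ ≤ ∑ i : Fin d, (2 * ‖toL2 q f‖ + 2 * ‖toL2 q f‖) := by
        refine Finset.sum_le_sum fun i _ => ?_
        rw [toL2_add q (hf.jumpBy _) (hf.jumpBy _)]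
        exact (norm_add_le _ _).trans
          (add_le_add (norm_toL2_jumpBy_le q _ hf) (norm_toL2_jumpBy_le q _ hf))
    _ = _ := by simp; ring

/-! ## The spectral gap -/

theorem KCSM.gap_set_nonneg (K : KCSM d) (q : I) {r : ℝ}
    (hr : ∃ f g : L2 d q, (f, g) ∈ K.envGenerator q ∧
      ProbabilityTheory.variance f (mu d q) ≠ 0 ∧
      r = -(∫ η, f η * g η ∂(mu d q)) / ProbabilityTheory.variance f (mu d q)) : 0 ≤ r := by
  obtain ⟨f, g, h, -, rfl⟩ := hr
  refine div_nonneg ?_ (ProbabilityTheory.variance_nonneg _ _)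
  rw [integral_mul_eq_inner]
  exact neg_nonneg.2 (closedGraph_dissipative q (K.isLocalOp_envOp q)
    (fun f hf => K.integral_envOp_mul_self_nonpos q hf) _ h)

theorem KCSM.gap_nonneg (K : KCSM d) (q : I) : 0 ≤ K.gap q :=
  Real.sInf_nonneg fun _ hr => K.gap_set_nonneg q hr

theorem KCSM.gap_mul_variance_le (K : KCSM d) (q : I) {f : Config d → ℝ} (hf : IsLocal f) :
    K.gap q * ProbabilityTheory.variance f (mu d q) ≤ -∫ η, K.envOp q f η * f η ∂(mu d q) := by
  have hv : ProbabilityTheory.variance (toL2 q f) (mu d q) =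
      ProbabilityTheory.variance f (mu d q) :=
    ProbabilityTheory.variance_congr (coeFn_toL2 q hf)
  -- Functions of zero variance do not enter the infimum; for them dissipativity suffices.
  rcases eq_or_ne (ProbabilityTheory.variance f (mu d q)) 0 with h0 | h0
  · rw [h0, mul_zero]
    exact neg_nonneg.2 (K.integral_envOp_mul_self_nonpos q hf)
  have hpos : 0 < ProbabilityTheory.variance f (mu d q) :=
    (ProbabilityTheory.variance_nonneg _ _).lt_of_ne' h0
  rw [← le_div_iff₀ hpos]
  refine csInf_le ⟨0, fun r hr => K.gap_set_nonneg q hr⟩ ⟨toL2 q f, toL2 q (K.envOp q f),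
    mem_closedGraph q (K.isLocalOp_envOp q) hf, by rwa [hv], ?_⟩
  rw [hv, integral_mul_eq_inner, inner_toL2 q hf (hf.envOp K q)]
  simp_rw [mul_comm]

theorem sum_bondForm_le (q : I) {f : Config d → ℝ} (hf : IsLocal f) :
    ∑ i, bondForm q (unitVec i) f f ≤ 4 * d * ProbabilityTheory.variance f (mu d q) := by
  rw [ProbabilityTheory.variance_eq_integral hf.measurable.aemeasurable]
  calc _ ≤ ∑ i : Fin d, 4 * ∫ η, (f η - ∫ η, f η ∂(mu d q)) ^ 2 ∂(mu d q) :=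
        Finset.sum_le_sum fun i _ => bondForm_self_le q _ hf _
    _ = _ := by simp; ring

/-- The `H₋₁` bound relative to the full generator, sharpened by the gap. Both sides are continuous
in `p`, so the inequality passes from local functions to the closure; being free of division, it
also covers a zero gap. -/
theorem KCSM.sq_inner_current_le (K : KCSM d) (q : I) (u : Fin d → ℝ) :
    ∀ p ∈ K.tracerGenerator q, (4 * d + K.gap q) * inner ℝ (toL2 q (current u)) p.1 ^ 2 ≤
      4 * d * ((q : ℝ) ^ 2 * ∑ i, u i ^ 2) * -inner ℝ p.1 p.2 := by
  refine closedGraph_induction q (K.isLocalOp_tracerOp q)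
    (isClosed_le (by fun_prop) (by fun_prop)) fun f hf => ?_
  rw [inner_toL2 q (isLocal_current u) hf, real_inner_comm,
    inner_toL2 q ((K.isLocalOp_tracerOp q).isLocal f hf) hf, K.integral_tracerOp_mul q hf hf]
  have h1 := sq_integral_current_mul_le q u hf
  have h2 := sum_bondForm_le q hf
  have h3 := K.gap_mul_variance_le q hf
  set E := ∑ i, bondForm q (unitVec i) f f
  set V := ProbabilityTheory.variance f (mu d q)
  have hU : 0 ≤ (q : ℝ) ^ 2 * ∑ i, u i ^ 2 := by positivity
  have hγ := K.gap_nonneg q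
  have hd : (0 : ℝ) ≤ d := Nat.cast_nonneg d
  have h4 : K.gap q * E ≤ 4 * d * -∫ η, K.envOp q f η * f η ∂(mu d q) :=
    calc K.gap q * E ≤ K.gap q * (4 * d * V) := by gcongr
      _ = 4 * d * (K.gap q * V) := by ring
      _ ≤ _ := by gcongr
  calc _ ≤ (4 * d + K.gap q) * (((q : ℝ) ^ 2 * ∑ i, u i ^ 2) * E) := by gcongr
    _ = ((q : ℝ) ^ 2 * ∑ i, u i ^ 2) * (4 * d * E + K.gap q * E) := by ring
    _ ≤ ((q : ℝ) ^ 2 * ∑ i, u i ^ 2) *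
        (4 * d * E + 4 * d * -∫ η, K.envOp q f η * f η ∂(mu d q)) := by
        exact mul_le_mul_of_nonneg_left (by linarith) hU
    _ = _ := by ring

end Tracer

namespace Tracer

variable {d : ℕ}

/-! ## The finite-volume resolvent equation -/

theorem KCSM.siteOp_add (K : KCSM d) (q : I) (y : Site d) (f g : Config d → ℝ) (η : Config d) :
    K.siteOp q y (fun η => f η + g η) η = K.siteOp q y f η + K.siteOp q y g η := by
  simp only [KCSM.siteOp, siteGrad_add]; ring

theorem KCSM.siteOp_const_mul (K : KCSM d) (q : I) (y : Site d) (c : ℝ) (f : Config d → ℝ)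
    (η : Config d) : K.siteOp q y (fun η => c * f η) η = c * K.siteOp q y f η := by
  simp only [KCSM.siteOp, siteGrad_const_mul]; ring

/-- The maximum principle. -/
theorem KCSM.nonpos_of_resolvent_eq_zero (K : KCSM d) (q : I) (S : Finset (Site d)) {l : ℝ}
    (hl : 0 < l) {f : Config d → ℝ} (hf : IsLocal f)
    (h : ∀ η, l * f η + ∑ y ∈ S, K.siteOp q y f η = 0) (η : Config d) : f η ≤ 0 := by
  -- A local function takes finitely many values, so its maximum is attained; there every `siteOp`
  -- term is nonnegative.
  obtain ⟨_, ⟨⟨ζ, rfl⟩, hζ⟩⟩ := Set.exists_max_image (Set.range f) id hf.finite_range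
    (Set.range_nonempty f)
  have hmax : ∀ η, f η ≤ f ζ := fun η => hζ _ ⟨η, rfl⟩
  have hsum : 0 ≤ ∑ y ∈ S, K.siteOp q y f ζ := by
    refine Finset.sum_nonneg fun y _ => mul_nonneg (K.ind_nonneg y ζ) ?_
    rw [siteGrad, resample]
    nlinarith [hmax (Function.update ζ y false), hmax (Function.update ζ y true), q.2.1, q.2.2]
  have h1 := h ζ
  exact (hmax η).trans (by nlinarith)

/-- When `B` contains the neighbourhoods of the active sites, functions on `B` form an invariant
finite-dimensional space, where injectivity, from the maximum principle for `f` and `-f`, implies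
surjectivity. -/
theorem KCSM.exists_resolvent_eq (K : KCSM d) (q : I) (S : Finset (Site d)) {l : ℝ} (hl : 0 < l)
    {B : Finset (Site d)} (hB : ∀ y ∈ S, ∀ a ∈ K.nbhd, y + a ∈ B) {g : Config d → ℝ}
    (hg : DependsOn g (B : Set (Site d))) :
    ∃ f, DependsOn f (B : Set (Site d)) ∧ ∀ η, l * f η + ∑ y ∈ S, K.siteOp q y f η = g η := by
  classical
  let W : Submodule ℝ (Config d → ℝ) :=
    { carrier := {f | DependsOn f (B : Set (Site d))}
      zero_mem' := fun _ _ _ => rfl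
      add_mem' := fun {f g} hf hg η η' h => by simp only [Pi.add_apply, hf h, hg h]
      smul_mem' := fun c f hf η η' h => by simp only [Pi.smul_apply, hf h] }
  let ext : (B → Bool) → Config d := fun ξ x => if h : x ∈ B then ξ ⟨x, h⟩ else false
  let R : W →ₗ[ℝ] ((B → Bool) → ℝ) :=
    { toFun := fun f ξ => f.1 (ext ξ)
      map_add' := fun _ _ => rfl
      map_smul' := fun _ _ => rfl }
  have hR : Function.Injective R := by
    intro f f' h
    refine Subtype.ext (funext fun η => ?_)
    have e : ∀ x ∈ (B : Set (Site d)), η x = ext (fun b => η b) x := fun x hx => by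
      simp only [ext, dif_pos (Finset.mem_coe.1 hx)]
    rw [f.2 e, f'.2 e]
    exact congrFun h fun b => η b
  have hfin : FiniteDimensional ℝ W := Module.Finite.of_injective R hR
  let M : W →ₗ[ℝ] W :=
    { toFun := fun f => ⟨fun η => l * f.1 η + ∑ y ∈ S, K.siteOp q y f.1 η, fun η η' h => by
        beta_reduce
        rw [f.2 h, Finset.sum_congr rfl fun y hy => K.dependsOn_siteOp q y (hB y hy) f.2 h]⟩
      map_add' := fun f f' => Subtype.ext (funext fun η => by
        change l * (f.1 η + f'.1 η) + ∑ y ∈ S, K.siteOp q y (fun η => f.1 η + f'.1 η) η =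
          (l * f.1 η + ∑ y ∈ S, K.siteOp q y f.1 η) + (l * f'.1 η + ∑ y ∈ S, K.siteOp q y f'.1 η)
        simp only [K.siteOp_add, Finset.sum_add_distrib]; ring)
      map_smul' := fun c f => Subtype.ext (funext fun η => by
        change l * (c * f.1 η) + ∑ y ∈ S, K.siteOp q y (fun η => c * f.1 η) η =
          c * (l * f.1 η + ∑ y ∈ S, K.siteOp q y f.1 η)
        simp only [K.siteOp_const_mul, ← Finset.mul_sum]; ring) }
  have hM : Function.Injective M := by
    rw [← LinearMap.ker_eq_bot, LinearMap.ker_eq_bot']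
    intro f hf
    have h1 : ∀ η, l * f.1 η + ∑ y ∈ S, K.siteOp q y f.1 η = 0 := fun η =>
      congrFun (congrArg Subtype.val hf) η
    have h2 : ∀ η, l * (-1 * f.1 η) + ∑ y ∈ S, K.siteOp q y (fun η => -1 * f.1 η) η = 0 :=
      fun η => by
        simp only [K.siteOp_const_mul, ← Finset.mul_sum]
        linarith [h1 η]
    have hloc : IsLocal f.1 := ⟨B, f.2⟩
    refine Subtype.ext (funext fun η => le_antisymm
      (K.nonpos_of_resolvent_eq_zero q S hl hloc h1 η) ?_)
    have := K.nonpos_of_resolvent_eq_zero q S hl (hloc.const_mul (-1)) h2 η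
    change (0 : ℝ) ≤ f.1 η
    linarith
  obtain ⟨f, hf⟩ := (LinearMap.injective_iff_surjective.1 hM) ⟨g, hg⟩
  exact ⟨f.1, f.2, fun η => congrFun (congrArg Subtype.val hf) η⟩

/-! ### Decay of influences and the approximate resolvent -/

/-- The `L²(μ)` norm of the dependence of `f` on the site `x`. -/
def influence (q : I) (x : Site d) (f : Config d → ℝ) : ℝ := ‖toL2 q (siteGrad q x f)‖

theorem influence_nonneg (q : I) (x : Site d) (f : Config d → ℝ) : 0 ≤ influence q x f :=
  norm_nonneg _

theorem KCSM.norm_toL2_siteOp_le (K : KCSM d) (q : I) (y : Site d) {f : Config d → ℝ}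
    (hf : IsLocal f) : ‖toL2 q (K.siteOp q y f)‖ ≤ influence q y f := by
  refine norm_toL2_le_of_abs_le q (hf.siteOp K q y) (hf.siteGrad q y) fun η => ?_
  rw [KCSM.siteOp, abs_mul, abs_of_nonneg (K.ind_nonneg y η)]
  exact mul_le_of_le_one_left (abs_nonneg _) (K.ind_le_one y η)

-- Apply `siteGrad q x` to the equation and test against `siteGrad q x f`. If the constraint at `y`
-- does not see `x`, the two operators commute and the term is nonnegative. The remaining terms are
-- bounded by Cauchy–Schwarz.
open Classical in
theorem KCSM.influence_resolvent_le (K : KCSM d) (q : I) (S : Finset (Site d)) {l : ℝ}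
    {f g : Config d → ℝ} (hf : IsLocal f) (hg : IsLocal g)
    (h : ∀ η, l * f η + ∑ y ∈ S, K.siteOp q y f η = g η) (x : Site d) :
    l * influence q x f ≤ influence q x g +
      ∑ y ∈ S with x ∈ K.nbhd.image (y + ·), influence q y f := by
  set N := influence q x f with hN
  have hDf := hf.siteGrad q x
  have hsite : ∀ y ∈ S, -(if x ∈ K.nbhd.image (y + ·) then N * influence q y f else 0) ≤
      ∫ η, siteGrad q x f η * siteGrad q x (K.siteOp q y f) η ∂(mu d q) := by
    intro y _
    split_ifs with hy
    · rw [integral_siteGrad_mul_siteGrad q x hf (hf.siteOp K q y),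
        ← inner_toL2 q hDf (hf.siteOp K q y)]
      have h1 := neg_le_of_abs_le (abs_real_inner_le_norm (toL2 q (siteGrad q x f))
        (toL2 q (K.siteOp q y f)))
      refine le_trans (neg_le_neg ?_) h1
      exact mul_le_mul_of_nonneg_left (K.norm_toL2_siteOp_le q y hf) (norm_nonneg _)
    · have hne : ∀ a ∈ K.nbhd, y + a ≠ x := fun a ha he =>
        hy (Finset.mem_image.2 ⟨a, ha, he⟩)
      have e : siteGrad q x (K.siteOp q y f) = K.siteOp q y (siteGrad q x f) := by
        have := siteGrad_mul_left q x (K.ind_update_of_forall_ne hne) (siteGrad q y f)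
        rw [siteGrad_comm] at this
        exact this
      rw [e, neg_zero]
      simpa only [mul_comm] using K.integral_siteOp_mul_self_nonneg q y hDf
  have hgrad : ∀ η, siteGrad q x f η * siteGrad q x g η =
      l * siteGrad q x f η ^ 2 +
        ∑ y ∈ S, siteGrad q x f η * siteGrad q x (K.siteOp q y f) η := by
    intro η
    have e : g = fun η => l * f η + ∑ y ∈ S, K.siteOp q y f η := funext fun η => (h η).symm
    rw [e, siteGrad_add, siteGrad_const_mul, siteGrad_sum, ← Finset.mul_sum]; ring
  have hint : ∫ η, siteGrad q x f η * siteGrad q x g η ∂(mu d q) = l * N ^ 2 +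
      ∑ y ∈ S, ∫ η, siteGrad q x f η * siteGrad q x (K.siteOp q y f) η ∂(mu d q) := by
    have hl : ∀ y ∈ S, IsLocal fun η => siteGrad q x f η * siteGrad q x (K.siteOp q y f) η :=
      fun y _ => hDf.mul ((hf.siteOp K q y).siteGrad q x)
    simp only [hgrad]
    rw [integral_add (((hDf.pow 2).const_mul l).integrable _) ((IsLocal.sum hl).integrable _),
      integral_finsetSum _ fun y hy => (hl y hy).integrable _, integral_const_mul, hN, influence,
      norm_toL2_sq q hDf]
  have hcs : ∫ η, siteGrad q x f η * siteGrad q x g η ∂(mu d q) ≤ N * influence q x g := by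
    rw [← inner_toL2 q hDf (hg.siteGrad q x)]
    exact real_inner_le_norm _ _
  have hsum := Finset.sum_le_sum hsite
  rw [Finset.sum_neg_distrib, ← Finset.sum_filter, ← Finset.mul_sum] at hsum
  set r := ∑ y ∈ S with x ∈ K.nbhd.image (y + ·), influence q y f with hr
  have hr0 : 0 ≤ r := Finset.sum_nonneg fun y _ => influence_nonneg q y f
  have hkey : N * (l * N) ≤ N * (influence q x g + r) := by nlinarith
  rcases (influence_nonneg q x f).eq_or_lt with h0 | h0
  · rw [hN, ← h0, mul_zero]
    exact add_nonneg (influence_nonneg q x g) hr0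
  · exact le_of_mul_le_mul_left hkey h0

/-- The growth of the weight `1 + ‖x‖` over the range of the constraints. -/
def KCSM.growth (K : KCSM d) : ℝ := 1 + ∑ a ∈ K.nbhd, ‖a‖

theorem KCSM.weight_add_le (K : KCSM d) (y : Site d) {a : Site d} (ha : a ∈ K.nbhd) :
    1 + ‖y + a‖ ≤ K.growth * (1 + ‖y‖) := by
  have h1 : ‖a‖ ≤ ∑ a ∈ K.nbhd, ‖a‖ :=
    Finset.single_le_sum (f := fun a => ‖a‖) (fun _ _ => norm_nonneg _) ha
  have h2 := norm_add_le y a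
  rw [KCSM.growth]
  nlinarith [norm_nonneg y, norm_nonneg a]

theorem KCSM.growth_pos (K : KCSM d) : 0 < K.growth := by
  have : 0 ≤ ∑ a ∈ K.nbhd, ‖a‖ := Finset.sum_nonneg fun _ _ => norm_nonneg _
  rw [KCSM.growth]; linarith

/-- Summing the influence inequality with weight `1 + ‖x‖`, each site feeds at most `K.nbhd.card`
others, at weight cost `K.growth`. The lower bound on `l` absorbs this with a margin of one,
uniformly in `S` and `B`. -/
theorem KCSM.sum_weight_mul_influence_le (K : KCSM d) (q : I) {S B : Finset (Site d)} (hSB : S ⊆ B)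
    {l : ℝ} (hl : K.nbhd.card * K.growth + 1 ≤ l) {f g : Config d → ℝ} (hf : IsLocal f)
    (hg : IsLocal g) (h : ∀ η, l * f η + ∑ y ∈ S, K.siteOp q y f η = g η) :
    ∑ x ∈ B, (1 + ‖x‖) * influence q x f ≤ ∑ x ∈ B, (1 + ‖x‖) * influence q x g := by
  classical
  set w : Site d → ℝ := fun x => 1 + ‖x‖ with hw
  have hw0 : ∀ x, 0 ≤ w x := fun x => by positivity
  have hN := fun x => influence_nonneg q x f
  have h1 : l * ∑ x ∈ B, w x * influence q x f ≤ ∑ x ∈ B, w x * influence q x g +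
      ∑ x ∈ B, ∑ y ∈ S with x ∈ K.nbhd.image (y + ·), w x * influence q y f := by
    rw [Finset.mul_sum, ← Finset.sum_add_distrib]
    refine Finset.sum_le_sum fun x _ => ?_
    have := mul_le_mul_of_nonneg_left (K.influence_resolvent_le q S hf hg h x) (hw0 x)
    rw [mul_add, Finset.mul_sum] at this
    linarith
  have h2 : ∑ x ∈ B, ∑ y ∈ S with x ∈ K.nbhd.image (y + ·), w x * influence q y f ≤
      K.nbhd.card * K.growth * ∑ y ∈ B, w y * influence q y f := by
    calc _ = ∑ y ∈ S, ∑ x ∈ B with x ∈ K.nbhd.image (y + ·), w x * influence q y f := by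
          simp only [Finset.sum_filter]; exact Finset.sum_comm
      _ ≤ ∑ y ∈ S, K.nbhd.card * K.growth * (w y * influence q y f) := by
          refine Finset.sum_le_sum fun y _ => ?_
          calc _ ≤ ∑ x ∈ K.nbhd.image (y + ·), w x * influence q y f :=
                Finset.sum_le_sum_of_subset_of_nonneg (fun x hx => (Finset.mem_filter.1 hx).2)
                  fun x _ _ => mul_nonneg (hw0 x) (hN y)
            _ = ∑ a ∈ K.nbhd, w (y + a) * influence q y f :=
                Finset.sum_image fun a _ b _ hab => add_left_cancel hab
            _ ≤ ∑ a ∈ K.nbhd, K.growth * w y * influence q y f :=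
                Finset.sum_le_sum fun a ha =>
                  mul_le_mul_of_nonneg_right (K.weight_add_le y ha) (hN y)
            _ = _ := by rw [Finset.sum_const, nsmul_eq_mul]; ring
      _ ≤ ∑ y ∈ B, K.nbhd.card * K.growth * (w y * influence q y f) :=
          Finset.sum_le_sum_of_subset_of_nonneg hSB fun y _ _ =>
            mul_nonneg (mul_nonneg (Nat.cast_nonneg _) K.growth_pos.le) (mul_nonneg (hw0 y) (hN y))
      _ = _ := by rw [Finset.mul_sum]
  have h3 : 0 ≤ ∑ x ∈ B, w x * influence q x f :=
    Finset.sum_nonneg fun x _ => mul_nonneg (hw0 x) (hN x)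
  nlinarith

theorem KCSM.exists_approx_resolvent (K : KCSM d) (q : I) {l : ℝ}
    (hl : K.nbhd.card * K.growth + 1 ≤ l) {g : Config d → ℝ} (hg : IsLocal g) {ε : ℝ}
    (hε : 0 < ε) :
    ∃ f, IsLocal f ∧ ‖l • toL2 q f - toL2 q (K.envOp q f) - toL2 q g‖ < ε := by
  classical
  have hl0 : 0 < l := by
    have := mul_nonneg (Nat.cast_nonneg (α := ℝ) K.nbhd.card) K.growth_pos.le
    linarith
  obtain ⟨A, hA⟩ := id hg
  set C := ∑ x ∈ A, (1 + ‖x‖) * influence q x g with hC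
  -- Neglected sites lie outside the ball of radius `n`, where the weight exceeds `n + 1`; their
  -- total influence is therefore at most `C / (n + 1) < ε`.
  obtain ⟨n, hn⟩ := exists_nat_gt (C / ε)
  have hfin : (Metric.closedBall (0 : Site d) n).Finite :=
    (isCompact_closedBall (0 : Site d) n).finite_of_discrete
  set S := hfin.toFinset with hS
  set B := A ∪ S ∪ S.biUnion (fun y => K.nbhd.image (y + ·)) with hB
  have hAB : A ⊆ B := Finset.subset_union_left.trans Finset.subset_union_left
  have hSB : S ⊆ B := Finset.subset_union_right.trans Finset.subset_union_left
  have hSN : ∀ y ∈ S, ∀ a ∈ K.nbhd, y + a ∈ B := fun y hy a ha =>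
    Finset.mem_union_right _ (Finset.mem_biUnion.2 ⟨y, hy, Finset.mem_image_of_mem _ ha⟩)
  obtain ⟨f, hfB, hf⟩ := K.exists_resolvent_eq q S hl0 hSN (hA.mono (Finset.coe_subset.2 hAB))
  have hfl : IsLocal f := ⟨B, hfB⟩
  refine ⟨f, hfl, ?_⟩
  have hw := K.sum_weight_mul_influence_le q hSB hl hfl hg hf
  have hC' : ∑ x ∈ B, (1 + ‖x‖) * influence q x g = C := by
    refine (Finset.sum_subset hAB fun x _ hx => ?_).symm
    have : siteGrad q x g = fun _ => 0 := funext fun η => siteGrad_eq_zero q (by simpa using hx) hA η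
    rw [influence, this, toL2_zero, norm_zero, mul_zero]
  rw [hC'] at hw
  have e : (fun η => l * f η - K.envOp q f η - g η) = fun η => ∑ y ∈ B \ S, K.siteOp q y f η := by
    funext η
    rw [K.envOp_eq q hfB, ← hf η]
    beta_reduce
    rw [← Finset.sum_sdiff hSB]; ring
  have e2 : l • toL2 q f - toL2 q (K.envOp q f) - toL2 q g =
      ∑ y ∈ B \ S, toL2 q (K.siteOp q y f) := by
    rw [← toL2_sum q _ fun y => hfl.siteOp K q y, ← e,
      toL2_sub q ((hfl.const_mul l).sub (hfl.envOp K q)) hg,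
      toL2_sub q (hfl.const_mul l) (hfl.envOp K q), toL2_const_mul q l hfl]
  rw [e2]
  have h1 : ‖∑ y ∈ B \ S, toL2 q (K.siteOp q y f)‖ ≤ ∑ y ∈ B \ S, influence q y f :=
    (norm_sum_le _ _).trans (Finset.sum_le_sum fun y _ => K.norm_toL2_siteOp_le q y hfl)
  have h2 : ((n : ℝ) + 1) * ∑ y ∈ B \ S, influence q y f ≤ C := by
    refine le_trans ?_ hw
    rw [Finset.mul_sum]
    calc _ ≤ ∑ y ∈ B \ S, (1 + ‖y‖) * influence q y f := by
          refine Finset.sum_le_sum fun y hy =>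
            mul_le_mul_of_nonneg_right ?_ (influence_nonneg q y f)
          have : ¬ ‖y‖ ≤ n := by simpa [hS] using (Finset.mem_sdiff.1 hy).2
          linarith
      _ ≤ _ := Finset.sum_le_sum_of_subset_of_nonneg Finset.sdiff_subset fun y _ _ =>
          mul_nonneg (by positivity) (influence_nonneg q y f)
  rw [div_lt_iff₀ hε] at hn
  have h3 : (0 : ℝ) ≤ n := Nat.cast_nonneg n
  by_contra! hc
  nlinarith [hc.trans h1]

/-! ## Existence of the semigroup -/

theorem KCSM.eq_zero_of_orthogonal_range (K : KCSM d) (q : I) {l : ℝ}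
    (hl : K.nbhd.card * K.growth + 1 ≤ l) (hld : 4 * d < l) (h : L2 d q)
    (hh : ∀ f, IsLocal f → inner ℝ h (l • toL2 q f - toL2 q (K.tracerOp q f)) = 0) : h = 0 := by
  have hd0 : (0 : ℝ) ≤ 4 * d := by positivity
  have hl0 : 0 < l := hd0.trans_lt hld
  -- Write `g ≈ (l - L_E) f` with `f` local. Orthogonality trades `⟨h, (l - L_E) f⟩` for the jump
  -- part of `f`, of norm at most `4d ‖f‖`, and `l ‖f‖` is at most about `‖g‖`. With `g` tending to
  -- `h`, the factor `4d / l < 1` forces `h = 0`.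
  have hbound : ∀ g, IsLocal g → inner ℝ h (toL2 q g) ≤ ‖h‖ * (4 * d / l * ‖toL2 q g‖) := by
    intro g hg
    have hε : ∀ ε > 0, inner ℝ h (toL2 q g) ≤
        ‖h‖ * (4 * d / l * (‖toL2 q g‖ + ε)) + ‖h‖ * ε := by
      intro ε hε
      obtain ⟨f, hf, hfg⟩ := K.exists_approx_resolvent q hl hg hε
      set p := l • toL2 q f - toL2 q (K.envOp q f) with hp
      have h1 : inner ℝ h p = inner ℝ h (toL2 q (jumpOp f)) := by
        have h2 := hh f hf
        have e : toL2 q (K.tracerOp q f) = toL2 q (K.envOp q f) + toL2 q (jumpOp f) :=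
          toL2_add q (hf.envOp K q) hf.jumpOp
        rw [e, ← sub_sub, inner_sub_right, sub_eq_zero] at h2
        exact h2
      have hdiss := closedGraph_dissipative q (K.isLocalOp_envOp q)
        (fun f hf => K.integral_envOp_mul_self_nonpos q hf) _
        (mem_closedGraph q (K.isLocalOp_envOp q) hf)
      have h2 : l * ‖toL2 q f‖ ≤ ‖p‖ := norm_le_norm_smul_sub hdiss l
      have h3 : ‖p‖ ≤ ‖toL2 q g‖ + ε := by
        have : p = toL2 q g + (p - toL2 q g) := by abel
        rw [this]
        exact (norm_add_le _ _).trans (by linarith)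
      have h4 : ‖toL2 q (jumpOp f)‖ ≤ 4 * d / l * (‖toL2 q g‖ + ε) := by
        refine (norm_toL2_jumpOp_le q hf).trans ?_
        rw [div_mul_eq_mul_div, le_div_iff₀ hl0, mul_assoc, mul_comm _ l]
        exact mul_le_mul_of_nonneg_left (h2.trans h3) hd0
      have e : toL2 q g = p - (p - toL2 q g) := by abel
      calc inner ℝ h (toL2 q g) = inner ℝ h (toL2 q (jumpOp f)) - inner ℝ h (p - toL2 q g) := by
            conv_lhs => rw [e]
            rw [inner_sub_right, h1]
        _ ≤ ‖h‖ * ‖toL2 q (jumpOp f)‖ + ‖h‖ * ‖p - toL2 q g‖ := by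
            have a := real_inner_le_norm h (toL2 q (jumpOp f))
            have b := neg_le_of_abs_le (abs_real_inner_le_norm h (p - toL2 q g))
            linarith
        _ ≤ _ := by gcongr
    have hlim : Tendsto (fun ε : ℝ => ‖h‖ * (4 * d / l * (‖toL2 q g‖ + ε)) + ‖h‖ * ε) (𝓝[>] 0)
        (𝓝 (‖h‖ * (4 * d / l * ‖toL2 q g‖))) :=
      (Continuous.tendsto' (by fun_prop) 0 _ (by simp)).mono_left nhdsWithin_le_nhds
    exact ge_of_tendsto hlim (eventually_nhdsWithin_of_forall hε)
  have hall : ∀ k : L2 d q, inner ℝ h k ≤ ‖h‖ * (4 * d / l * ‖k‖) := by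
    intro k
    have hcl : IsClosed {k : L2 d q | inner ℝ h k ≤ ‖h‖ * (4 * d / l * ‖k‖)} :=
      isClosed_le (by fun_prop) (by fun_prop)
    have hsub : {p : L2 d q | ∃ f, IsLocal f ∧ p = toL2 q f} ⊆
        {k : L2 d q | inner ℝ h k ≤ ‖h‖ * (4 * d / l * ‖k‖)} := by
      rintro _ ⟨f, hf, rfl⟩
      exact hbound f hf
    exact closure_minimal hsub hcl (dense_toL2 q k)
  have h1 := hall h
  rw [real_inner_self_eq_norm_sq] at h1
  have h2 : 4 * d / l < 1 := (div_lt_one hl0).2 hld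
  by_contra hne
  have h3 := norm_pos_iff.2 hne
  nlinarith [mul_pos h3 h3]

theorem KCSM.exists_semigroup (K : KCSM d) (q : I) :
    ∃ S : ContractionSemigroup (L2 d q), S.HasGenerator (K.tracerGenerator q) := by
  have hT := K.isLocalOp_tracerOp q
  have hneg : ∀ f, IsLocal f → ∫ η, K.tracerOp q f η * f η ∂(mu d q) ≤ 0 := fun f hf =>
    K.integral_tracerOp_mul_self_nonpos q hf
  have hdiss := closedGraph_dissipative q hT hneg
  have hdense := dense_domain_closedGraph q hT
  have h0 : 0 ≤ K.nbhd.card * K.growth := mul_nonneg (Nat.cast_nonneg _) K.growth_pos.le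
  have hd0 : (0 : ℝ) ≤ d := Nat.cast_nonneg d
  have hsurj : ∀ l ≥ K.nbhd.card * K.growth + 1 + 4 * d, ∀ h : L2 d q,
      ∃ p ∈ closedGraph q (K.tracerOp q), l • p.1 - p.2 = h := fun l hl h =>
    closedGraph_surjective q hT hneg (by linarith)
      (K.eq_zero_of_orthogonal_range q (by linarith) (by linarith)) h
  rw [KCSM.tracerGenerator]
  rw [closedGraph_eq q hT] at hdiss hdense hsurj ⊢
  exact exists_contractionSemigroup hdiss hdense (by linarith) hsurj

end Tracer

namespace Tracer

variable {d : ℕ}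

/-! ## The diffusion matrix -/

/-- The semigroup of the environment seen from the tracer. -/
def KCSM.semigroup (K : KCSM d) (q : I) : ContractionSemigroup (L2 d q) :=
  (K.exists_semigroup q).choose

theorem KCSM.hasGenerator (K : KCSM d) (q : I) :
    (K.semigroup q).HasGenerator (K.tracerGenerator q) :=
  (K.exists_semigroup q).choose_spec

theorem KCSM.expOp_eq (K : KCSM d) (q : I) (t : ℝ≥0) :
    expOp (K.tracerGenerator q) t = (K.semigroup q).op t := by
  rw [expOp, dif_pos (K.exists_semigroup q)]
  -- Both sides are the same choice from the same existence statement, so uniqueness of the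
  -- semigroup is not needed.
  rfl

theorem KCSM.inner_op_left (K : KCSM d) (q : I) (t : ℝ≥0) (f h : L2 d q) :
    inner ℝ ((K.semigroup q).op t f) h = inner ℝ f ((K.semigroup q).op t h) :=
  (K.hasGenerator q).inner_op_left
    (closedGraph_symm q (K.isLocalOp_tracerOp q) fun _ _ hf hg =>
      K.integral_tracerOp_mul_comm q hf hg)
    (dense_domain_closedGraph q (K.isLocalOp_tracerOp q)) t f h

theorem KCSM.corr_eq (K : KCSM d) (q : I) (u v : Fin d → ℝ) (t : ℝ≥0) :
    K.corr q u v t =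
      inner ℝ (toL2 q (current u)) ((K.semigroup q).op t (toL2 q (current v))) := by
  have e : (memLp_current q v).toLp (current v) = toL2 q (current v) :=
    eq_toL2 q (isLocal_current v) (MemLp.coeFn_toLp _)
  rw [KCSM.corr, K.expOp_eq, e, real_inner_comm, inner_toL2_right q _ (isLocal_current u)]

theorem KCSM.corr_comm (K : KCSM d) (q : I) (u v : Fin d → ℝ) (t : ℝ≥0) :
    K.corr q u v t = K.corr q v u t := by
  rw [K.corr_eq, K.corr_eq, ← K.inner_op_left, real_inner_comm]

theorem KCSM.corr_add_eq (K : KCSM d) (q : I) (u : Fin d → ℝ) (s t : ℝ≥0) :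
    K.corr q u u (s + t) = inner ℝ ((K.semigroup q).op s (toL2 q (current u)))
      ((K.semigroup q).op t (toL2 q (current u))) := by
  rw [K.corr_eq, ContractionSemigroup.op_add_apply, K.inner_op_left]

/-- Splitting the time in half, symmetry turns the autocorrelation into `‖e^{(t/2)L} j_u‖²`. -/
theorem KCSM.corr_self_nonneg (K : KCSM d) (q : I) (u : Fin d → ℝ) (t : ℝ≥0) :
    0 ≤ K.corr q u u t := by
  rw [← add_halves t, K.corr_add_eq]
  exact real_inner_self_nonneg

theorem KCSM.continuous_corr (K : KCSM d) (q : I) (u v : Fin d → ℝ) :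
    Continuous fun t : ℝ => K.corr q u v t.toNNReal := by
  simp only [K.corr_eq]
  exact continuous_const.inner ((K.semigroup q).continuous_op_toNNReal _)

theorem toL2_current (q : I) (u : Fin d → ℝ) :
    toL2 q (current u) = ∑ i, u i • toL2 q (current (Pi.single i 1)) := by
  have h : current u = fun η => ∑ i, u i * current (Pi.single i 1) η := by
    funext η
    simp only [current_eq]
    refine Finset.sum_congr rfl fun i _ => ?_
    rw [Finset.sum_eq_single i (fun j _ hj => by simp [hj]) (by simp)]
    simp
  conv_lhs => rw [h]
  rw [toL2_sum q _ fun i => (isLocal_current _).const_mul _]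
  exact Finset.sum_congr rfl fun i _ => toL2_const_mul q _ (isLocal_current _)

theorem KCSM.corr_self_eq_sum (K : KCSM d) (q : I) (u : Fin d → ℝ) (t : ℝ≥0) :
    K.corr q u u t =
      ∑ i, ∑ k, u i * u k * K.corr q (Pi.single i 1) (Pi.single k 1) t := by
  simp only [K.corr_eq]
  rw [toL2_current q u, map_sum, sum_inner]
  refine Finset.sum_congr rfl fun i _ => ?_
  rw [inner_sum]
  refine Finset.sum_congr rfl fun k _ => ?_
  rw [map_smul, real_inner_smul_left, real_inner_smul_right]; ring

theorem KCSM.corr_add_add (K : KCSM d) (q : I) (u v : Fin d → ℝ) (t : ℝ≥0) :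
    K.corr q (u + v) (u + v) t = K.corr q u u t + 2 * K.corr q u v t + K.corr q v v t := by
  have h : toL2 q (current (u + v)) = toL2 q (current u) + toL2 q (current v) := by
    rw [← toL2_add q (isLocal_current u) (isLocal_current v)]
    congr 1
    funext η
    simp only [current_eq, Pi.add_apply, add_mul, Finset.sum_add_distrib]
  have hc := K.corr_comm q u v t
  simp only [K.corr_eq] at hc ⊢
  rw [h, map_add, inner_add_left, inner_add_right, inner_add_right, ← hc]; ring

/-- The bound on the time integral of the current autocorrelation. -/
theorem KCSM.integral_corr_le (K : KCSM d) (q : I) (hd : 1 ≤ d) (u : Fin d → ℝ) {s : ℝ}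
    (hs : 0 ≤ s) :
    ∫ t in (0 : ℝ)..s, K.corr q u u t.toNNReal ≤
      4 * d / (4 * d + K.gap q) * ((q : ℝ) ^ 2 * ∑ i, u i ^ 2) := by
  set j := toL2 q (current u) with hj
  set S := K.semigroup q with hS
  set F := ∫ t in (0 : ℝ)..s, S.op t.toNNReal j with hF
  set J := ∫ t in (0 : ℝ)..s, K.corr q u u t.toNNReal with hJ
  have hint : IntervalIntegrable (fun t : ℝ => S.op t.toNNReal j) volume 0 s :=
    (S.continuous_op_toNNReal j).intervalIntegrable _ _
  have hmem : (F, S.op s.toNNReal j - j) ∈ K.tracerGenerator q :=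
    (K.hasGenerator q).integral_mem j hs
  have hinner : ∀ h : L2 d q, inner ℝ h F = ∫ t in (0 : ℝ)..s, inner ℝ h (S.op t.toNNReal j) :=
    fun h => ((innerSL ℝ h).intervalIntegral_comp_comm hint).symm
  have hjF : inner ℝ j F = J := by
    rw [hinner, hJ]
    simp only [K.corr_eq, hj, hS]
  have hJ0 : 0 ≤ J := intervalIntegral.integral_nonneg hs fun t _ => K.corr_self_nonneg q u _
  -- This is the integral of the autocorrelation over `[s, 2s]`.
  have hpos : 0 ≤ inner ℝ (S.op s.toNNReal j) F := by
    rw [hinner]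
    refine intervalIntegral.integral_nonneg hs fun t _ => ?_
    rw [hS, hj, ← K.corr_add_eq]
    exact K.corr_self_nonneg q u _
  have hkey := K.sq_inner_current_le q u _ hmem
  simp only [← hj] at hkey
  rw [hjF, inner_sub_right, real_inner_comm j F, hjF, real_inner_comm] at hkey
  set U := (q : ℝ) ^ 2 * ∑ i, u i ^ 2 with hU
  have hU0 : 0 ≤ U := by positivity
  have hd0 : (1 : ℝ) ≤ d := by exact_mod_cast hd
  have hγ := K.gap_nonneg q
  have hc : 0 < 4 * d + K.gap q := by linarith
  rw [div_mul_eq_mul_div, le_div_iff₀ hc]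
  -- Here `-⟨F, L F⟩ = J - ⟨S_s j, F⟩ ≤ J`; one factor `J` then cancels unless `J = 0`.
  have h1 : (4 * d + K.gap q) * J ^ 2 ≤ 4 * d * U * J :=
    hkey.trans (mul_le_mul_of_nonneg_left (by linarith) (by positivity))
  rcases hJ0.eq_or_lt with h0 | h0
  · rw [← h0, zero_mul]; positivity
  · refine le_of_mul_le_mul_right ?_ h0
    linarith

theorem KCSM.integrableOn_corr_self (K : KCSM d) (q : I) (hd : 1 ≤ d) (u : Fin d → ℝ) :
    IntegrableOn (fun t : ℝ => K.corr q u u t.toNNReal) (Set.Ioi 0) volume := by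
  refine integrableOn_Ioi_of_intervalIntegral_norm_bounded
    (4 * d / (4 * d + K.gap q) * ((q : ℝ) ^ 2 * ∑ i, u i ^ 2)) 0
    (fun s : ℝ => (K.continuous_corr q u u).integrableOn_Ioc) tendsto_id ?_
  filter_upwards [eventually_ge_atTop 0] with s hs
  simp only [Real.norm_of_nonneg (K.corr_self_nonneg q u _), id_eq]
  exact K.integral_corr_le q hd u hs

theorem KCSM.integral_Ioi_corr_le (K : KCSM d) (q : I) (hd : 1 ≤ d) (u : Fin d → ℝ) :
    ∫ t in Set.Ioi (0 : ℝ), K.corr q u u t.toNNReal ≤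
      4 * d / (4 * d + K.gap q) * ((q : ℝ) ^ 2 * ∑ i, u i ^ 2) := by
  refine le_of_tendsto (intervalIntegral_tendsto_integral_Ioi 0
    (K.integrableOn_corr_self q hd u) tendsto_id) ?_
  filter_upwards [eventually_ge_atTop 0] with s hs
  exact K.integral_corr_le q hd u hs

/-- Polarization from the autocorrelations of `u + v`, `u` and `v`. -/
theorem KCSM.integrableOn_corr (K : KCSM d) (q : I) (hd : 1 ≤ d) (u v : Fin d → ℝ) :
    IntegrableOn (fun t : ℝ => K.corr q u v t.toNNReal) (Set.Ioi 0) volume := by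
  have h := ((((K.integrableOn_corr_self q hd (u + v)).sub
    (K.integrableOn_corr_self q hd u)).sub (K.integrableOn_corr_self q hd v)).const_mul (1 / 2))
  refine h.congr (Eventually.of_forall fun t => ?_)
  simp only [Pi.sub_apply, K.corr_add_add]; ring

theorem KCSM.diffusionMatrix_quadraticForm (K : KCSM d) (q : I) (hd : 1 ≤ d) (u : Fin d → ℝ) :
    u ⬝ᵥ (K.diffusionMatrix q).mulVec u = (q : ℝ) ^ 2 * ∑ i, u i ^ 2 -
      ∫ t in Set.Ioi (0 : ℝ), K.corr q u u t.toNNReal := by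
  have hint := fun i k : Fin d =>
    (K.integrableOn_corr q hd (Pi.single i 1) (Pi.single k 1)).const_mul (u i * u k)
  simp only [K.corr_self_eq_sum q u]
  rw [integral_finsetSum _ fun i _ => integrable_finsetSum _ fun k _ => hint i k]
  simp_rw [fun i => integral_finsetSum Finset.univ fun k _ => hint i k, integral_const_mul]
  simp only [dotProduct, Matrix.mulVec, KCSM.diffusionMatrix, Matrix.of_apply, sub_mul,
    Finset.sum_sub_distrib, mul_sub, Finset.mul_sum, ite_mul, zero_mul, Finset.sum_ite_eq,
    Finset.mem_univ, if_true]
  congr 1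
  · exact Finset.sum_congr rfl fun i _ => by ring
  · exact Finset.sum_congr rfl fun i _ => Finset.sum_congr rfl fun k _ => by ring

theorem KCSM.diffusionMatrix_quadraticForm_le (K : KCSM d) (q : I) (hd : 1 ≤ d)
    (u : Fin d → ℝ) :
    u ⬝ᵥ (K.diffusionMatrix q).mulVec u ≤ (q : ℝ) ^ 2 * ∑ i, u i ^ 2 := by
  rw [K.diffusionMatrix_quadraticForm q hd u]
  exact sub_le_self _ (integral_nonneg fun t => K.corr_self_nonneg q u _)

theorem KCSM.le_diffusionMatrix_quadraticForm (K : KCSM d) (q : I) (hd : 1 ≤ d)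
    (u : Fin d → ℝ) :
    K.gap q / (4 * d + K.gap q) * ((q : ℝ) ^ 2 * ∑ i, u i ^ 2) ≤
      u ⬝ᵥ (K.diffusionMatrix q).mulVec u := by
  rw [K.diffusionMatrix_quadraticForm q hd u]
  have h := K.integral_Ioi_corr_le q hd u
  have hd0 : (1 : ℝ) ≤ d := by exact_mod_cast hd
  have hc : 0 < 4 * d + K.gap q := by linarith [K.gap_nonneg q]
  have e : K.gap q / (4 * d + K.gap q) = 1 - 4 * d / (4 * d + K.gap q) := by
    field_simp; ring
  rw [e, sub_mul, one_mul]
  linarith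

theorem KCSM.posDef_diffusionMatrix (K : KCSM d) (q : I) (hd : 1 ≤ d) (hq : 0 < q)
    (hgap : 0 < K.gap q) : (K.diffusionMatrix q).PosDef := by
  refine Matrix.PosDef.of_dotProduct_mulVec_pos ?_ fun u hu => ?_
  · ext i k
    simp only [Matrix.conjTranspose_apply, KCSM.diffusionMatrix, Matrix.of_apply, star_trivial,
      eq_comm (a := k), K.corr_comm q (Pi.single k 1)]
  · have h := K.le_diffusionMatrix_quadraticForm q hd u
    refine lt_of_lt_of_le ?_ (by simpa using h)
    obtain ⟨i, hi⟩ := Function.ne_iff.1 hu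
    have h1 : 0 < ∑ i, u i ^ 2 :=
      Finset.sum_pos' (fun i _ => sq_nonneg _) ⟨i, Finset.mem_univ i, by
        have : u i ≠ 0 := hi
        positivity⟩
    have h2 : (0 : ℝ) < q := hq
    positivity

end Tracer

end

open Tracer in
theorem proposition2 (d : ℕ) (hd : 1 ≤ d) (q : unitInterval) (hq0 : 0 < q) (hq1 : q < 1)
    (K : KCSM d) :
    -- the semigroup `e^{tL}` exists
    (∃ S : ContractionSemigroup (L2 d q), S.HasGenerator (K.tracerGenerator q)) ∧
    -- the diffusion matrix is well defined and is given by the usual formula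
    (∀ u : Fin d → ℝ,
      IntegrableOn (fun t : ℝ => K.corr q u u t.toNNReal) (Set.Ioi 0) volume ∧
      u ⬝ᵥ (K.diffusionMatrix q).mulVec u = (q : ℝ) ^ 2 * ∑ i, u i ^ 2 -
        ∫ t in Set.Ioi (0 : ℝ), K.corr q u u t.toNNReal) ∧
    -- the bounds
    (∀ u : Fin d → ℝ,
      u ⬝ᵥ (K.diffusionMatrix q).mulVec u ≤ (q : ℝ) ^ 2 * ∑ i, u i ^ 2 ∧
      K.gap q / (4 * d + K.gap q) * ((q : ℝ) ^ 2 * ∑ i, u i ^ 2) ≤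
        u ⬝ᵥ (K.diffusionMatrix q).mulVec u) ∧
    -- positivity
    (0 < K.gap q → (K.diffusionMatrix q).PosDef) :=
  ⟨K.exists_semigroup q,
    fun u => ⟨K.integrableOn_corr_self q hd u, K.diffusionMatrix_quadraticForm q hd u⟩,
    fun u => ⟨K.diffusionMatrix_quadraticForm_le q hd u,
      K.le_diffusionMatrix_quadraticForm q hd u⟩,
    K.posDef_diffusionMatrix q hd hq0⟩
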